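/- Let $F(x)={}_2F_1(\tfrac12,\tfrac12;1;x)$ and, with $\psi=\Gamma'/\Gamma$, $$F_1(x)=\sum_{n\ge 0}\frac{[(1/2)_n]^2}{(n!)^2}\,2\left[\psi(n+\tfrac12)-\psi(n+1)\right]x^n ,\qquad |x|<1 .$$ Let $\mathbf K(x)=\int_0^1\frac{d\zeta}{\sqrt{(1-\zeta^2)(1-x\zeta^2)}}$, $\omega_1(x)=\mathbf K(x)$, $\omega_2(x)=i\mathbf K(1-x)$, and for $\nu_1,\nu_2\in\mathbb C$ let $$y(x)=\wp(\nu_1\omega_1(x)+\nu_2\omega_2(x);\omega_1(x),\omega_2(x))+\frac{1+x}{3}$$ be the Picard function, where $\wp(\,\cdot\,;\omega_1,\omega_2)$ is the Weierstrass function with half-periods $\omega_1,\omega_2$. (By a classical result of Picard, which is background and not part of the claim, these functions solve the Painlevé equation $PVI_{1/2}$.) 1. (Half-periods.) For $0<|x|<1$, $|\arg x|<\pi$ one has $\omega_1(x)=\frac{\pi}{2}F(x)$ and $\omega_2(x)=-\frac i2[F(x)\ln x+F_1(x)]$. The right-hand sides are holomorphic functions of $t=\ln x$ on $\{\Re t<0\}$,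 the universal covering of the punctured disk $0<|x|<1$, on which $y$ is therefore also defined. 2. (Lagrange inversion.) $F$ has no zero in $|a|<1$, and $\phi(a)=\frac1{16}\exp\{-F_1(a)/F(a)\}$ is holomorphic there. If $0<\xi_0<1$ and $|x|<|16a|\,|\exp\{F_1(a)/F(a)\}|$ whenever $|a|=\xi_0$, then the equation $\xi=\frac{x}{16}\exp\{-F_1(\xi)/F(\xi)\}$ has exactly one root in $|\xi|<\xi_0$, and it is the sum of the convergent series $$\xi(x)=\sum_{n\ge1}\frac{x^n}{n!}\left.\frac{d^{n-1}}{da^{n-1}}\left[\phi(a)^n\right]\right|_{a=0}.$$ This series has positive radius of convergence, and $$\xi(x)=x-\tfrac12x^2+\tfrac{11}{64}x^3-\tfrac{3}{64}x^4+\tfrac{359}{32768}x^5-\tfrac{75}{32768}x^6+\tfrac{919}{2097152}x^7+\cdots .$$ 3. (Poles.) For $k,N\in\mathbb Z$ with $2N+\nu_2\neq0$ let $$x_{kN}=16\exp\left\{i\pi\frac{2k-\nu_1}{2N+\nu_2}\right\},\qquad \ln x_{kN}=\ln16+i\pi\frac{2k-\nu_1}{2N+\nu_2},$$ regarded as a point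 of the universal covering, and let $\xi_{kN}=\xi(x_{kN})$, regarded as the point of the universal covering with $\ln \xi_{kN}=\ln x_{kN}+\ln(\xi(x_{kN})/x_{kN})$, the last logarithm being principal. There are $\rho>0$ and $0<r<1$ such that, for all $\nu_1,\nu_2$ that are not both even integers (otherwise $y\equiv\infty$): every $\xi_{kN}$ with $2N+\nu_2\ne0$ and $|x_{kN}|<\rho$ is a pole of $y$ on the universal covering of the punctured unit disk; and every pole of $y$ on it with $|x|<r$ is one of these $\xi_{kN}$. 4. (Spirals.) Let $2N+\nu_2\neq0$. Then for every $k\in\mathbb Z$ $$x_{kN}=x_{0N}\exp\left\{2\pi\frac{\Im\nu_2}{|\nu_2+2N|^2}k\right\}\exp\left\{2\pi i\,\frac{\Re\nu_2+2N}{|\nu_2+2N|^2}k\right\}.$$ If $\Im\nu_2<0$ (resp. $\Im\nu_2>0$), then $x_{kN}\to0$ as $k\to+\infty$ (resp. $k\to-\infty$). If $\Im\nu_2\ne0$ and $\Re\nu_2\neq-2N$, the points $x_{kN}$, $k\in\mathbb Z$, lie on a logarithmic spiral around $0$; if $\Re\nu_2=-2N$, they lie on a ray from $0$. 5. (One sheet.)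 For all $\nu_1,\nu_2$ there is $\varepsilon>0$ such that $|x_{kN}|\ge\varepsilon$ for all $k,N\in\mathbb Z$ with $\Re\nu_2\ne-2N$ and $-\pi\le\arg x_{kN}<\pi$, where $\arg x_{kN}=\Im\ln x_{kN}$. -/

import Mathlib

noncomputable section

namespace PicardPoles

/-- The complete elliptic integral `K(m) = ∫₀¹ dζ / √((1 - ζ²)(1 - m ζ²))`, with the principal
square root (relevant for `m` outside the cut `[1, ∞)`). -/
def ellK (m : ℂ) : ℂ :=
  ∫ ζ in (0 : ℝ)..1, 1 / (((1 - (ζ : ℂ) ^ 2) * (1 - m * (ζ : ℂ) ^ 2)) ^ (1 / 2 : ℂ))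

/-- The half-period `ω₁(x) = K(x)`. -/
def omega1 (x : ℂ) : ℂ := ellK x

/-- The half-period `ω₂(x) = i K(1 - x)`. -/
def omega2 (x : ℂ) : ℂ := Complex.I * ellK (1 - x)

open Classical in
/-- The Weierstrass function `℘(z; w₁, w₂)` with *half*-periods `w₁, w₂`, that is, with period
lattice `2 w₁ ℤ + 2 w₂ ℤ` (set to `0` when the two numbers are linearly dependent over `ℝ`). -/
def wp (w₁ w₂ z : ℂ) : ℂ :=
  if h : LinearIndependent ℝ ![2 * w₁, 2 * w₂] then
    (PeriodPair.mk (2 * w₁) (2 * w₂) h).weierstrassP z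
  else 0

/-- The branch of the Picard function in the plane cut by `|arg x| < π`, `|arg (1 - x)| < π`. -/
def picard (ν₁ ν₂ x : ℂ) : ℂ :=
  wp (omega1 x) (omega2 x) (ν₁ * omega1 x + ν₂ * omega2 x) + (1 + x) / 3

/-- The Gauss hypergeometric function `F(1/2, 1/2, 1; x)`. -/
def F (x : ℂ) : ℂ := ordinaryHypergeometric (1 / 2 : ℂ) (1 / 2 : ℂ) (1 : ℂ) x

/-- `F₁(x) = ∑ₙ [(1/2)ₙ]² / (n!)² · 2 [ψ(n + 1/2) - ψ(n + 1)] xⁿ`. -/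
def F₁ (x : ℂ) : ℂ :=
  ∑' n : ℕ, ((ascPochhammer ℂ n).eval (1 / 2 : ℂ)) ^ 2 / ((n.factorial : ℂ)) ^ 2 *
    (2 * (Complex.digamma ((n : ℂ) + 1 / 2) - Complex.digamma ((n : ℂ) + 1))) * x ^ n

/-!
The universal covering of the punctured unit disk `0 < |x| < 1` is the half-plane `Re t < 0`, with
covering map `x = exp t`; thus `t` plays the role of the many-valued `ln x`.
-/

/-- `ω₁` on the universal covering. -/
def omega1Cov (t : ℂ) : ℂ := (Real.pi : ℂ) / 2 * F (Complex.exp t)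

/-- `ω₂` on the universal covering, `-(i/2) [F(x) ln x + F₁(x)]`. -/
def omega2Cov (t : ℂ) : ℂ :=
  -(Complex.I / 2) * (F (Complex.exp t) * t + F₁ (Complex.exp t))

/-- The Picard function on the universal covering of the punctured unit disk. -/
def picardCov (ν₁ ν₂ t : ℂ) : ℂ :=
  wp (omega1Cov t) (omega2Cov t) (ν₁ * omega1Cov t + ν₂ * omega2Cov t) + (1 + Complex.exp t) / 3

/-- `f` has a pole at `t`. -/
def IsPole (f : ℂ → ℂ) (t : ℂ) : Prop :=
  MeromorphicAt f t ∧ meromorphicOrderAt f t < 0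

/-- `φ(a) = (1/16) exp(-F₁(a)/F(a))`. -/
def phi (a : ℂ) : ℂ := 1 / 16 * Complex.exp (-(F₁ a / F a))

/-- The coefficient of `x ^ (n + 1)` in Lagrange's series,
`(1/(n+1)!) (dⁿ/daⁿ) [φ(a)ⁿ⁺¹]` at `a = 0`. -/
def xiCoeff (n : ℕ) : ℂ :=
  iteratedDeriv n (fun a : ℂ => phi a ^ (n + 1)) 0 / ((n + 1).factorial : ℂ)

/-- Lagrange's series `ξ(x)`. -/
def xi (x : ℂ) : ℂ := ∑' n : ℕ, xiCoeff n * x ^ (n + 1)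

/-- The lift of `x ↦ ξ(x) = x (1 + δ(x))` to the universal covering,
`ln ξ = ln x + ln (1 + δ(x))`, with the principal logarithm of `1 + δ(x) = ξ(x) / x`. -/
def xiLift (T : ℂ) : ℂ := T + Complex.log (xi (Complex.exp T) / Complex.exp T)

/-- `x_{kN} = 16 exp(iπ (2k - ν₁)/(2N + ν₂))`. -/
def xkN (ν₁ ν₂ : ℂ) (k N : ℤ) : ℂ :=
  16 * Complex.exp (Complex.I * Real.pi * ((2 * k - ν₁) / (2 * N + ν₂)))

/-- `x_{kN}` as a point of the universal covering:
`ln x_{kN} = ln 16 + iπ (2k - ν₁)/(2N + ν₂)`. -/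
def xkNLift (ν₁ ν₂ : ℂ) (k N : ℤ) : ℂ :=
  (Real.log 16 : ℂ) + Complex.I * Real.pi * ((2 * k - ν₁) / (2 * N + ν₂))

/-- `S` is a logarithmic spiral around `0`: `s ↦ c exp((a + ib)s)` with `c, a, b` nonzero. -/
def IsLogSpiral (S : Set ℂ) : Prop :=
  ∃ (c : ℂ) (a b : ℝ), c ≠ 0 ∧ a ≠ 0 ∧ b ≠ 0 ∧
    S = Set.range fun s : ℝ => c * Complex.exp (((a : ℂ) + b * Complex.I) * s)

end PicardPoles

end

/-! ### Power series of `F` and `F₁` and their differential equations. -/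

noncomputable section
namespace PicardPoles

/-! Write `τ = ω₂/ω₁`. On the covering, `ω₂ = -(i/2) F · L` and `ω₁ = (π/2) F`, where `L(t) = t +
F₁/F(eᵗ) = iπτ` is `logNome`. Since `F` has no zero in the disk, the argument `ν₁ω₁ + ν₂ω₂` meets
the lattice point `2kω₁ - 2Nω₂` exactly when `(2N + ν₂) L(t) = iπ(2k - ν₁)`
(`argument_eq_latPt_iff`). For `2N + ν₂ ≠ 0` this says `t + E(eᵗ) = ln x_{kN}` with `E = F₁/F + ln
16` and `E(0) = 0`. Exponentiated, it is Lagrange's equation `ξ = x_{kN} φ(ξ)`, so the poles near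
`0` are the points `ξ(x_{kN})`.

The half-periods: `F` and `U = F ln x + F₁` solve one self-adjoint equation `(x(1-x)y')' = y/4`,
which is invariant under `x ↦ 1 - x`, and their Wronskian is normalized to `1` (`wronskian_eq_one`).
Hence `F(1 - x)` is a constant combination of the two near the segment `(0,1)`. The constants come
from `K(1-x) + (ln x)/2 → ln 4` (`tendsto_ellK_one_sub`), and the identity theorem carries the
formula to the cut disk (`ellK_one_sub_eq_U`). Positivity of the real part of the integrand of `K`
gives `F ≠ 0` (`re_F_pos`).

Lagrange inversion: the hypothesis makes `a ↦ xφ(a)` a strict self map of a closed disk. A strict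
Schwarz-Pick inequality gives exactly one fixed point, and a simple one
(`exists_unique_fixedPoint`). The series comes from expanding the residue integral of `a h'/h`,
`h(a) = a - xφ(a)` (`lagrange_inversion`). The Wronskian identity turns into a first-order equation
for `φ`, which produces the numerical coefficients without the series of `F₁`.

That lattice coincidences are poles, and the only ones, needs `℘` with moving periods: locally it is
analytic plus finitely many terms `1/(z - lattice point)²` (`wp_eventually_eq`). Uniqueness in
Lagrange's equation shows that the denominator does not vanish identically. The statements on
spirals and on one sheet follow from the real and imaginary parts of `(2k - ν₁)/(2N + ν₂)`. -/

/-- The sum of the power series with coefficients `a`. -/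
def psum (a : ℕ → ℂ) (x : ℂ) : ℂ := ∑' n, a n * x ^ n

/-- A sequence of at most polynomial growth. -/
def PolyBdd (a : ℕ → ℂ) : Prop := ∃ (C : ℝ) (k : ℕ), ∀ n, ‖a n‖ ≤ C * ((n : ℝ) + 1) ^ k

/-- The coefficients of the derivative of a power series. -/
def dcoef (a : ℕ → ℂ) (n : ℕ) : ℂ := (n + 1) * a (n + 1)

lemma summable_poly_geom (k : ℕ) {r : ℝ} (hr0 : 0 ≤ r) (hr : r < 1) :
    Summable fun n : ℕ => ((n : ℝ) + 1) ^ k * r ^ n := by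
  rcases hr0.eq_or_lt with rfl | h0
  · refine summable_of_ne_finset_zero (s := {0}) fun n hn => ?_
    simp at hn
    simp [hn]
  have h1 : Summable fun n : ℕ => (n : ℝ) ^ k * r ^ n :=
    summable_pow_mul_geometric_of_norm_lt_one k (by rwa [Real.norm_of_nonneg hr0])
  have h := (summable_nat_add_iff (f := fun n : ℕ => (n : ℝ) ^ k * r ^ n) 1).2 h1
  refine (h.mul_right r⁻¹).congr fun n => ?_
  push_cast
  field_simp
  ring

lemma PolyBdd.dcoef {a : ℕ → ℂ} (h : PolyBdd a) : PolyBdd (dcoef a) := by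
  obtain ⟨C, k, hC⟩ := h
  have hC0 : 0 ≤ C := by simpa using (norm_nonneg _).trans (hC 0)
  refine ⟨C * 2 ^ k, k + 1, fun n => ?_⟩
  have h1 := hC (n + 1)
  have h2 : ‖PicardPoles.dcoef a n‖ = ((n : ℝ) + 1) * ‖a (n + 1)‖ := by
    rw [PicardPoles.dcoef, norm_mul]
    congr 1
    exact_mod_cast Complex.norm_natCast (n + 1)
  rw [h2]
  have h3 : ((n : ℝ) + 1 + 1) ^ k ≤ (2 * ((n : ℝ) + 1)) ^ k := by
    gcongr; linarith [n.cast_nonneg (α := ℝ)]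
  push_cast at h1
  calc ((n : ℝ) + 1) * ‖a (n + 1)‖ ≤ ((n : ℝ) + 1) * (C * (2 * ((n : ℝ) + 1)) ^ k) := by
        gcongr; exact h1.trans (by gcongr)
    _ = _ := by rw [mul_pow]; ring

lemma PolyBdd.summable_norm {a : ℕ → ℂ} (h : PolyBdd a) {r : ℝ} (h0 : 0 ≤ r) (hr : r < 1) :
    Summable fun n => ‖a n‖ * r ^ n := by
  obtain ⟨C, k, hC⟩ := h
  refine Summable.of_nonneg_of_le (fun n => by positivity) (fun n => ?_)
    ((summable_poly_geom k h0 hr).mul_left C)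
  rw [← mul_assoc]
  gcongr
  exact hC n

lemma PolyBdd.summable {a : ℕ → ℂ} (h : PolyBdd a) {x : ℂ} (hx : ‖x‖ < 1) :
    Summable fun n => a n * x ^ n := by
  refine Summable.of_norm ?_
  simpa using h.summable_norm (norm_nonneg x) hx

lemma PolyBdd.hasDerivAt {a : ℕ → ℂ} (h : PolyBdd a) {x : ℂ} (hx : ‖x‖ < 1) :
    HasDerivAt (psum a) (psum (PicardPoles.dcoef a) x) x := by
  obtain ⟨r, hxr, hr⟩ := exists_between hx
  have hr0 : 0 ≤ r := (norm_nonneg x).trans hxr.le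
  have hu := h.summable_norm hr0 hr
  have hd : ∀ n : ℕ, DifferentiableOn ℂ (fun w : ℂ => a n * w ^ n) (Metric.ball 0 r) :=
    fun n => by fun_prop
  have hle : ∀ (n : ℕ) (w : ℂ), w ∈ Metric.ball (0 : ℂ) r → ‖a n * w ^ n‖ ≤ ‖a n‖ * r ^ n := by
    intro n w hw
    rw [norm_mul, norm_pow]
    have : ‖w‖ ≤ r := by simpa using (mem_ball_zero_iff.1 hw).le
    gcongr
  have hxm : x ∈ Metric.ball (0 : ℂ) r := by simpa using hxr
  have h1 := Complex.differentiableOn_tsum_of_summable_norm hu hd Metric.isOpen_ball hle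
  have h2 := Complex.hasSum_deriv_of_summable_norm hu hd Metric.isOpen_ball hle hxm
  have h3 := (h1.differentiableAt (Metric.isOpen_ball.mem_nhds hxm)).hasDerivAt
  have h4 : deriv (fun w : ℂ => ∑' n, a n * w ^ n) x = psum (PicardPoles.dcoef a) x := by
    rw [← h2.tsum_eq, h2.summable.tsum_eq_zero_add]
    simp only [pow_zero, mul_one, deriv_const, zero_add, psum]
    refine tsum_congr fun n => ?_
    simp [PicardPoles.dcoef]
    ring
  rw [h4] at h3
  exact h3

lemma PolyBdd.differentiableOn {a : ℕ → ℂ} (h : PolyBdd a) :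
    DifferentiableOn ℂ (psum a) (Metric.ball 0 1) := fun _ hx =>
  (h.hasDerivAt (mem_ball_zero_iff.1 hx)).differentiableAt.differentiableWithinAt

/-- The coefficients of `x (1 - x) y'` for `y = ∑ aₙ xⁿ`. -/
def ecoef (a : ℕ → ℂ) : ℕ → ℂ
  | 0 => 0
  | n + 1 => (n + 1) * a (n + 1) - n * a n

lemma PolyBdd.ecoef {a : ℕ → ℂ} (h : PolyBdd a) : PolyBdd (ecoef a) := by
  obtain ⟨C, k, hC⟩ := h
  have hC0 : 0 ≤ C := by simpa using (norm_nonneg _).trans (hC 0)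
  refine ⟨2 * C, k + 1, fun n => ?_⟩
  cases n with
  | zero => simp [PicardPoles.ecoef, hC0]
  | succ n =>
    have h1 := hC (n + 1)
    have h2 := hC n
    have e1 : ‖((n : ℂ) + 1) * a (n + 1)‖ = ((n : ℝ) + 1) * ‖a (n + 1)‖ := by
      rw [norm_mul]; congr 1; exact_mod_cast Complex.norm_natCast (n + 1)
    have e2 : ‖(n : ℂ) * a n‖ = (n : ℝ) * ‖a n‖ := by rw [norm_mul, Complex.norm_natCast]
    have hn := n.cast_nonneg (α := ℝ)
    refine (norm_sub_le _ _).trans ?_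
    rw [e1, e2]
    push_cast at h1 ⊢
    have h3 : ((n : ℝ) + 1) ^ k ≤ ((n : ℝ) + 1 + 1) ^ k := by gcongr; linarith
    calc ((n : ℝ) + 1) * ‖a (n + 1)‖ + n * ‖a n‖
        ≤ ((n : ℝ) + 1 + 1) * (C * ((n : ℝ) + 1 + 1) ^ k)
          + ((n : ℝ) + 1 + 1) * (C * ((n : ℝ) + 1 + 1) ^ k) := by
          gcongr
          · linarith
          · linarith
          · exact h2.trans (by gcongr)
      _ = _ := by ring

/-- Working with `x(1-x)y'` as a power series of its own lets the second-order equations below be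
checked by one differentiation and a coefficient comparison. -/
lemma psum_ecoef {a : ℕ → ℂ} (h : PolyBdd a) {x : ℂ} (hx : ‖x‖ < 1) :
    psum (ecoef a) x = x * (1 - x) * psum (dcoef a) x := by
  have s1 := h.dcoef.summable hx
  have s2 : Summable fun n : ℕ => (n : ℂ) * a n * x ^ n := by
    rw [← summable_nat_add_iff 1]
    refine (s1.mul_left x).congr fun n => ?_
    simp [dcoef]; ring
  have e2 : ∑' n : ℕ, (n : ℂ) * a n * x ^ n = x * psum (dcoef a) x := by
    rw [s2.tsum_eq_zero_add, psum, ← tsum_mul_left]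
    simp only [Nat.cast_zero, zero_mul, zero_add]
    refine tsum_congr fun n => ?_
    simp [dcoef]; ring
  rw [psum, (h.ecoef.summable hx).tsum_eq_zero_add]
  simp only [ecoef, zero_mul, zero_add]
  have : ∀ n : ℕ, (((n : ℂ) + 1) * a (n + 1) - n * a n) * x ^ (n + 1)
      = x * (dcoef a n * x ^ n) - x * (n * a n * x ^ n) := fun n => by simp only [dcoef]; ring
  rw [tsum_congr this, (s1.mul_left x).tsum_sub (s2.mul_left x), tsum_mul_left, tsum_mul_left, e2,
    psum]
  ring

/-- The coefficients of `F`. -/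
def hc (n : ℕ) : ℂ := ((ascPochhammer ℂ n).eval (1 / 2 : ℂ)) ^ 2 / ((n.factorial : ℂ)) ^ 2

/-- The numbers `2 [ψ(n + 1/2) - ψ(n + 1)]`. -/
def hd (n : ℕ) : ℂ :=
  2 * (Complex.digamma ((n : ℂ) + 1 / 2) - Complex.digamma ((n : ℂ) + 1))

/-- The coefficients of `F₁`. -/
def hb (n : ℕ) : ℂ := hc n * hd n

lemma F_eq_psum : F = psum hc := by
  funext x
  rw [F, ordinaryHypergeometric_eq_tsum, psum]
  refine tsum_congr fun n => ?_
  have hn : (n.factorial : ℂ) ≠ 0 := by exact_mod_cast n.factorial_ne_zero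
  rw [hc, ascPochhammer_eval_one, smul_eq_mul]
  field_simp

lemma F₁_eq_psum : F₁ = psum hb := rfl

lemma hc_zero : hc 0 = 1 := by simp [hc]

lemma hc_succ (n : ℕ) : hc (n + 1) = hc n * ((n + 1 / 2) / (n + 1)) ^ 2 := by
  have hn : (n.factorial : ℂ) ≠ 0 := by exact_mod_cast n.factorial_ne_zero
  have hn1 : (n : ℂ) + 1 ≠ 0 := by exact_mod_cast n.succ_ne_zero
  rw [hc, hc, ascPochhammer_succ_eval, Nat.factorial_succ]
  push_cast
  field_simp
  ring

lemma hd_zero : hd 0 = -(Real.log 16 : ℂ) := by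
  have : Real.log 16 = 4 * Real.log 2 := by
    rw [show (16 : ℝ) = 2 ^ 4 by norm_num, Real.log_pow]; norm_num
  rw [hd, this]
  simp only [Nat.cast_zero, zero_add]
  rw [Complex.digamma_one, Complex.digamma_one_half]
  push_cast
  rw [← Complex.ofNat_log]
  ring

lemma hd_succ (n : ℕ) : hd (n + 1) = hd n + 2 / (n + 1 / 2) - 2 / (n + 1) := by
  have h1 := Complex.digamma_apply_add_one ((n : ℂ) + 1 / 2) (by
    intro m h
    have := congrArg Complex.re h
    simp at this
    have h0 := n.cast_nonneg (α := ℝ)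
    have h1 := m.cast_nonneg (α := ℝ)
    linarith)
  have h2 := Complex.digamma_apply_add_one ((n : ℂ) + 1) (by
    intro m h
    have := congrArg Complex.re h
    simp at this
    have h0 := n.cast_nonneg (α := ℝ)
    have h1 := m.cast_nonneg (α := ℝ)
    linarith)
  rw [hd, hd]
  push_cast
  rw [show (n : ℂ) + 1 + 1 / 2 = n + 1 / 2 + 1 by ring, h1, h2]
  ring

lemma norm_hc_le (n : ℕ) : ‖hc n‖ ≤ 1 := by
  induction n with
  | zero => simp [hc_zero]
  | succ n ih =>
    have hn := n.cast_nonneg (α := ℝ)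
    have : ((n : ℂ) + 1 / 2) / (n + 1) = (((n : ℝ) + 1 / 2) / (n + 1) : ℝ) := by push_cast; rfl
    rw [hc_succ, norm_mul, norm_pow, this, Complex.norm_real, Real.norm_of_nonneg (by positivity)]
    have h2 : ((n : ℝ) + 1 / 2) / (n + 1) ≤ 1 := by rw [div_le_one (by positivity)]; linarith
    calc _ ≤ (1 : ℝ) * 1 ^ 2 := by gcongr
      _ = 1 := by norm_num

lemma polyBdd_hc : PolyBdd hc := ⟨1, 0, fun n => by simpa using norm_hc_le n⟩

/-- A crude linear bound: by `hd_succ` successive values differ by at most `4 + 2 = 6`. Polynomial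
growth is all that convergence in the unit disk requires. -/
lemma norm_hd_le (n : ℕ) : ‖hd n‖ ≤ (‖hd 0‖ + 6) * ((n : ℝ) + 1) := by
  induction n with
  | zero => simp
  | succ n ih =>
    have hn := n.cast_nonneg (α := ℝ)
    have : (2 : ℂ) / (n + 1 / 2) - 2 / (n + 1) = ((2 / (n + 1 / 2) - 2 / (n + 1) : ℝ) : ℂ) := by
      push_cast; rfl
    rw [hd_succ, add_sub_assoc, this]
    refine (norm_add_le _ _).trans ?_
    rw [Complex.norm_real]
    have h4 : (2 : ℝ) / (n + 1 / 2) ≤ 4 := by rw [div_le_iff₀ (by positivity)]; linarith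
    have h2 : (2 : ℝ) / (n + 1) ≤ 2 := by rw [div_le_iff₀ (by positivity)]; linarith
    have h40 : (0 : ℝ) ≤ 2 / (n + 1 / 2) := by positivity
    have h20 : (0 : ℝ) ≤ 2 / (n + 1) := by positivity
    have : ‖(2 : ℝ) / (n + 1 / 2) - 2 / (n + 1)‖ ≤ 6 := by
      rw [Real.norm_eq_abs, abs_le]; constructor <;> linarith
    push_cast
    nlinarith [norm_nonneg (hd 0)]

lemma polyBdd_hb : PolyBdd hb := by
  refine ⟨‖hd 0‖ + 6, 1, fun n => ?_⟩
  rw [hb, norm_mul, pow_one]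
  exact (mul_le_of_le_one_left (norm_nonneg _) (norm_hc_le n)).trans (norm_hd_le n)

/-- The derivative of `F` in the unit disk. -/
def dF (x : ℂ) : ℂ := psum (dcoef hc) x

/-- The derivative of `F₁` in the unit disk. -/
def dF₁ (x : ℂ) : ℂ := psum (dcoef hb) x

lemma hasDerivAt_F {x : ℂ} (hx : ‖x‖ < 1) : HasDerivAt F (dF x) x :=
  F_eq_psum ▸ polyBdd_hc.hasDerivAt hx

lemma hasDerivAt_F₁ {x : ℂ} (hx : ‖x‖ < 1) : HasDerivAt F₁ (dF₁ x) x :=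
  F₁_eq_psum ▸ polyBdd_hb.hasDerivAt hx

lemma differentiableOn_F : DifferentiableOn ℂ F (Metric.ball 0 1) :=
  F_eq_psum ▸ polyBdd_hc.differentiableOn

lemma psum_eventuallyEq {a : ℕ → ℂ} (h : PolyBdd a) {x : ℂ} (hx : ‖x‖ < 1) :
    psum (ecoef a) =ᶠ[nhds x] fun x => x * (1 - x) * psum (dcoef a) x := by
  filter_upwards [Metric.isOpen_ball.mem_nhds (mem_ball_zero_iff.2 hx)] with y hy
  exact psum_ecoef h (mem_ball_zero_iff.1 hy)

/-- The hypergeometric equation for `F`. -/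
lemma hasDerivAt_mul_dF {x : ℂ} (hx : ‖x‖ < 1) :
    HasDerivAt (fun x => x * (1 - x) * dF x) (F x / 4) x := by
  have h := (polyBdd_hc.ecoef.hasDerivAt hx).congr_of_eventuallyEq
    (psum_eventuallyEq polyBdd_hc hx).symm
  refine h.congr_deriv ?_
  rw [F_eq_psum, psum, psum, ← tsum_div_const]
  refine tsum_congr fun n => ?_
  have hn1 : (n : ℂ) + 1 ≠ 0 := by exact_mod_cast n.succ_ne_zero
  simp only [dcoef, ecoef]
  rw [hc_succ]
  field_simp
  ring

/-- The differential equation for `F₁`. -/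
lemma hasDerivAt_mul_dF₁ {x : ℂ} (hx : ‖x‖ < 1) :
    HasDerivAt (fun x => x * (1 - x) * dF₁ x) (F₁ x / 4 + F x - 2 * (1 - x) * dF x) x := by
  have h := (polyBdd_hb.ecoef.hasDerivAt hx).congr_of_eventuallyEq
    (psum_eventuallyEq polyBdd_hb hx).symm
  refine h.congr_deriv ?_
  have s1 := polyBdd_hb.summable hx
  have s2 := polyBdd_hc.summable hx
  have s3 := polyBdd_hc.dcoef.summable hx
  have s4 : Summable fun n : ℕ => (n : ℂ) * hc n * x ^ n := by
    rw [← summable_nat_add_iff 1]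
    refine (s3.mul_left x).congr fun n => ?_
    simp [dcoef]; ring
  have e4 : ∑' n : ℕ, (n : ℂ) * hc n * x ^ n = x * dF x := by
    rw [s4.tsum_eq_zero_add, dF, psum, ← tsum_mul_left]
    simp only [Nat.cast_zero, zero_mul, zero_add]
    refine tsum_congr fun n => ?_
    simp [dcoef]; ring
  have key : HasSum (fun n => hb n * x ^ n / 4 + hc n * x ^ n - 2 * (dcoef hc n * x ^ n)
      + 2 * (n * hc n * x ^ n)) (F₁ x / 4 + F x - 2 * dF x + 2 * (x * dF x)) := by
    rw [← e4, F_eq_psum, F₁_eq_psum]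
    exact (((s1.hasSum.div_const 4).add s2.hasSum).sub (s3.hasSum.mul_left 2)).add
      (s4.hasSum.mul_left 2)
  rw [show F₁ x / 4 + F x - 2 * (1 - x) * dF x = F₁ x / 4 + F x - 2 * dF x + 2 * (x * dF x) by
    ring, ← key.tsum_eq, psum]
  refine tsum_congr fun n => ?_
  have hn1 : (n : ℂ) + 1 ≠ 0 := by exact_mod_cast n.succ_ne_zero
  have hn3 : 2 * (n : ℂ) + 1 ≠ 0 := by exact_mod_cast (2 * n).succ_ne_zero
  -- The inverse of `2n + 1` is made an atom `w`, so that the final identity is polynomial modulo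
  -- `(2n + 1) w = 1`.
  have hn2 : (2 : ℂ) / (n + 1 / 2) = 4 * (2 * (n : ℂ) + 1)⁻¹ := by
    rw [show (n : ℂ) + 1 / 2 = (2 * n + 1) / 2 by ring]; field_simp
    norm_num
  have hw := mul_inv_cancel₀ hn3
  simp only [dcoef, ecoef, hb]
  rw [hc_succ, hd_succ, hn2]
  generalize (2 * (n : ℂ) + 1)⁻¹ = w at hw ⊢
  field_simp
  linear_combination hc n * x ^ n * (32 * n ^ 2 + 48 * n + 16) * hw

end PicardPoles
end

/-! ### The complete elliptic integral: trigonometric form, series, and zero-freeness of `F`. -/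

noncomputable section
namespace PicardPoles
open Filter Topology Set MeasureTheory
open scoped Interval

/-- Joint continuity bounds the derivative on the compact product of a small closed ball with `[a,
b]`, and this constant serves as the dominating function. -/
lemma hasDerivAt_intervalIntegral_of_continuousOn {f f' : ℂ → ℝ → ℂ} {U : Set ℂ} {a b : ℝ}
    (hab : a ≤ b) (hU : IsOpen U)
    (hf : ContinuousOn (Function.uncurry f) (U ×ˢ Icc a b))
    (hf' : ContinuousOn (Function.uncurry f') (U ×ˢ Icc a b))
    (hd : ∀ m ∈ U, ∀ s ∈ Icc a b, HasDerivAt (fun w => f w s) (f' m s) m) {m : ℂ} (hm : m ∈ U) :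
    HasDerivAt (fun w => ∫ s in a..b, f w s) (∫ s in a..b, f' m s) m := by
  obtain ⟨ε, hε, hball⟩ := Metric.nhds_basis_closedBall.mem_iff.1 (hU.mem_nhds hm)
  obtain ⟨M, hM⟩ := ((isCompact_closedBall m ε).prod (isCompact_Icc (a := a) (b := b))
    |>.exists_bound_of_continuousOn (hf'.mono (Set.prod_mono hball subset_rfl)))
  have slice : ∀ g : ℂ → ℝ → ℂ, ContinuousOn (Function.uncurry g) (U ×ˢ Icc a b) →
      ∀ w ∈ U, ContinuousOn (g w) (Icc a b) := fun g hg w hw =>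
    hg.comp (f := fun s => (w, s)) (by fun_prop) fun s hs => ⟨hw, hs⟩
  have hsub : Ι a b ⊆ Icc a b := by rw [uIoc_of_le hab]; exact Ioc_subset_Icc_self
  have meas : ∀ g : ℂ → ℝ → ℂ, ContinuousOn (Function.uncurry g) (U ×ˢ Icc a b) →
      ∀ w ∈ U, AEStronglyMeasurable (g w) (volume.restrict (Ι a b)) := fun g hg w hw =>
    ((slice g hg w hw).mono hsub).aestronglyMeasurable measurableSet_uIoc
  refine (intervalIntegral.hasDerivAt_integral_of_dominated_loc_of_deriv_le
    (Metric.closedBall_mem_nhds m hε) (bound := fun _ => M) ?_ ?_ ?_ ?_ ?_ ?_).2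
  · filter_upwards [hU.mem_nhds hm] with w hw using meas f hf w hw
  · refine ContinuousOn.intervalIntegrable ?_
    rw [uIcc_of_le hab]
    exact slice f hf m hm
  · exact meas f' hf' m hm
  · exact Eventually.of_forall fun s hs w hw => hM (w, s) ⟨hw, hsub hs⟩
  · simp
  · exact Eventually.of_forall fun s hs w hw => hd w (hball hw) s (hsub hs)

/-- The integrand of the complete elliptic integral in trigonometric form. -/
def ellInt (m : ℂ) (θ : ℝ) : ℂ := (1 - m * (Real.sin θ : ℂ) ^ 2) ^ (-(1 / 2) : ℂ)

/-- The slit plane is star-shaped about `1`, and `1 - ms` lies on the segment from `1` to `1 - m`.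
-/
lemma one_sub_mul_mem_slitPlane {m : ℂ} (hm : 1 - m ∈ Complex.slitPlane) {s : ℝ} (h0 : 0 ≤ s)
    (h1 : s ≤ 1) : 1 - m * (s : ℂ) ∈ Complex.slitPlane := by
  have := Complex.starConvex_one_slitPlane hm (sub_nonneg.2 h1) h0 (by ring)
  convert this using 1
  simp only [Complex.real_smul]
  push_cast
  ring

lemma one_sub_mul_sin_mem_slitPlane {m : ℂ} (hm : 1 - m ∈ Complex.slitPlane) (θ : ℝ) :
    1 - m * (Real.sin θ : ℂ) ^ 2 ∈ Complex.slitPlane := by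
  have := one_sub_mul_mem_slitPlane hm (sq_nonneg (Real.sin θ)) (Real.sin_sq_le_one θ)
  push_cast at this ⊢
  exact this

/-- The principal square root is not multiplicative in general. It splits here because one factor,
`cos² θ`, is a positive real. -/
lemma cos_mul_sqrt_inv {m : ℂ} (hm : 1 - m ∈ Complex.slitPlane) {θ : ℝ} (hθ : 0 < Real.cos θ) :
    (Real.cos θ : ℂ) * (1 / (((1 - (Real.sin θ : ℂ) ^ 2) * (1 - m * (Real.sin θ : ℂ) ^ 2))
      ^ (1 / 2 : ℂ))) = ellInt m θ := by
  have hz := Complex.slitPlane_ne_zero (one_sub_mul_sin_mem_slitPlane hm θ)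
  have hc : (1 - (Real.sin θ : ℂ) ^ 2) = ((Real.cos θ ^ 2 : ℝ) : ℂ) := by
    rw [Real.cos_sq']; push_cast; rfl
  have hc0 : (Real.cos θ : ℂ) ≠ 0 := by exact_mod_cast hθ.ne'
  rw [hc, ellInt, Complex.cpow_neg]
  set z := 1 - m * (Real.sin θ : ℂ) ^ 2
  rw [Complex.cpow_def_of_ne_zero (mul_ne_zero (by exact_mod_cast (pow_pos hθ 2).ne') hz),
    Complex.log_ofReal_mul (pow_pos hθ 2) hz, Real.log_pow, add_mul, Complex.exp_add,
    ← Complex.cpow_def_of_ne_zero hz]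
  have : (((2 : ℕ) * Real.log (Real.cos θ) : ℝ) : ℂ) * (1 / 2) = (Real.log (Real.cos θ) : ℝ) := by
    push_cast; ring
  rw [this, ← Complex.ofReal_exp, Real.exp_log hθ]
  have hz2 : z ^ (1 / 2 : ℂ) ≠ 0 := by rw [Complex.cpow_ne_zero_iff]; exact Or.inl hz
  field_simp

/-- The substitution `ζ = sin θ` removes the endpoint singularity at `ζ = 1`. The point `θ = π/2`,
where `cos θ = 0`, is discarded as a null set. -/
lemma ellK_eq_integral {m : ℂ} (hm : 1 - m ∈ Complex.slitPlane) :
    ellK m = ∫ θ in (0 : ℝ)..(Real.pi / 2), ellInt m θ := by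
  have hpi := Real.pi_pos
  have h := intervalIntegral.integral_deriv_smul_comp_of_deriv_nonneg (a := 0) (b := Real.pi / 2)
    (f := Real.sin) (f' := Real.cos)
    (g := fun ζ : ℝ => 1 / (((1 - (ζ : ℂ) ^ 2) * (1 - m * (ζ : ℂ) ^ 2)) ^ (1 / 2 : ℂ)))
    Real.continuous_sin.continuousOn (fun x _ => Real.hasDerivAt_sin x) (fun x hx => by
      rw [min_eq_left (by positivity), max_eq_right (by positivity)] at hx
      exact Real.cos_nonneg_of_mem_Icc ⟨by linarith [hx.1], hx.2.le⟩)
  rw [Real.sin_zero, Real.sin_pi_div_two] at h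
  rw [ellK, ← h]
  refine intervalIntegral.integral_congr_ae ?_
  have : ∀ᵐ θ : ℝ, θ ≠ Real.pi / 2 := compl_mem_ae_iff.2 (measure_singleton _)
  filter_upwards [this] with θ hne hθ
  rw [uIoc_of_le (by positivity)] at hθ
  have hcos : 0 < Real.cos θ :=
    Real.cos_pos_of_mem_Ioo ⟨by linarith [hθ.1], lt_of_le_of_ne hθ.2 hne⟩
  rw [← cos_mul_sqrt_inv hm hcos]
  simp only [Function.comp_apply, Complex.real_smul]

lemma isOpen_one_sub_slitPlane : IsOpen {m : ℂ | 1 - m ∈ Complex.slitPlane} :=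
  Complex.isOpen_slitPlane.preimage (by fun_prop)

lemma continuousOn_ellInt_cpow (c : ℂ) : ContinuousOn
    (fun p : ℂ × ℝ => (1 - p.1 * (Real.sin p.2 : ℂ) ^ 2) ^ c)
    ({m : ℂ | 1 - m ∈ Complex.slitPlane} ×ˢ Icc 0 (Real.pi / 2)) := by
  refine ContinuousOn.cpow_const ?_ fun p hp => one_sub_mul_sin_mem_slitPlane hp.1 p.2
  fun_prop

lemma continuous_ellInt {m : ℂ} (hm : 1 - m ∈ Complex.slitPlane) : Continuous (ellInt m) := by
  unfold ellInt
  refine Continuous.cpow (by fun_prop) continuous_const fun θ =>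
    one_sub_mul_sin_mem_slitPlane hm θ

lemma differentiableOn_ellK : DifferentiableOn ℂ ellK {m : ℂ | 1 - m ∈ Complex.slitPlane} := by
  have hpi := Real.pi_pos
  intro m hm
  have h := hasDerivAt_intervalIntegral_of_continuousOn (f := ellInt)
    (f' := fun m θ => -(1 / 2) * (1 - m * (Real.sin θ : ℂ) ^ 2) ^ (-(1 / 2) - 1 : ℂ)
      * -((Real.sin θ : ℂ) ^ 2)) (a := 0) (b := Real.pi / 2) (by positivity)
    isOpen_one_sub_slitPlane (continuousOn_ellInt_cpow _)
    ((continuousOn_const.mul (continuousOn_ellInt_cpow (-(1 / 2) - 1))).mul (by fun_prop)) (fun w hw s _ => by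
      have h1 : HasDerivAt (fun w : ℂ => 1 - w * (Real.sin s : ℂ) ^ 2) (-((Real.sin s : ℂ) ^ 2)) w := by
        simpa using ((hasDerivAt_id w).mul_const ((Real.sin s : ℂ) ^ 2)).const_sub 1
      exact h1.cpow_const (one_sub_mul_sin_mem_slitPlane hw s)) hm
  refine (h.differentiableAt.congr_of_eventuallyEq ?_).differentiableWithinAt
  filter_upwards [isOpen_one_sub_slitPlane.mem_nhds hm] with w hw using ellK_eq_integral hw

/-- The binomial coefficients `(1/2)ₙ / n!`. -/
def bc (n : ℕ) : ℂ := (ascPochhammer ℂ n).eval (1 / 2 : ℂ) / n.factorial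

lemma hc_eq_bc_sq (n : ℕ) : hc n = bc n ^ 2 := by rw [hc, bc, div_pow]

lemma norm_bc_le (n : ℕ) : ‖bc n‖ ≤ 1 := by
  have := norm_hc_le n
  rw [hc_eq_bc_sq, norm_pow] at this
  exact (sq_le_one_iff₀ (norm_nonneg _)).1 this

lemma hasSum_inv_sqrt {z : ℂ} (hz : ‖z‖ < 1) :
    HasSum (fun n => bc n * z ^ n) ((1 - z) ^ (-(1 / 2) : ℂ)) := by
  have h := (Complex.one_div_one_sub_cpow_hasFPowerSeriesOnBall_zero (1 / 2)).hasSum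
    (y := z) (by simpa [enorm_eq_nnnorm] using (by exact_mod_cast hz : ‖z‖₊ < 1))
  have h2 : (1 : ℂ) / (1 - (0 + z)) ^ (1 / 2 : ℂ) = (1 - z) ^ (-(1 / 2) : ℂ) := by
    rw [zero_add, one_div, ← Complex.cpow_neg]
  rw [h2] at h
  suffices e : ∀ n : ℕ, (FormalMultilinearSeries.ofScalars ℂ (𝕜 := ℂ)
      (fun n : ℕ => Ring.choose ((1 / 2 : ℂ) + n - 1) n) n) (fun _ => z) = bc n * z ^ n by
    simpa only [e] using h
  intro n
  have hn : (n.factorial : ℂ) ≠ 0 := by exact_mod_cast n.factorial_ne_zero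
  have h3 := Ring.factorial_nsmul_multichoose_eq_ascPochhammer (1 / 2 : ℂ) n
  rw [Polynomial.ascPochhammer_smeval_eq_eval, Ring.multichoose_eq, nsmul_eq_mul] at h3
  rw [FormalMultilinearSeries.ofScalars_apply_eq, smul_eq_mul, bc, ← h3]
  field_simp

lemma bc_succ (n : ℕ) : bc (n + 1) = bc n * ((n + 1 / 2) / (n + 1)) := by
  have hn : (n.factorial : ℂ) ≠ 0 := by exact_mod_cast n.factorial_ne_zero
  have hn1 : (n : ℂ) + 1 ≠ 0 := by exact_mod_cast n.succ_ne_zero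
  rw [bc, bc, ascPochhammer_succ_eval, Nat.factorial_succ]
  push_cast
  field_simp
  ring

lemma integral_sin_pow_two_mul (n : ℕ) :
    ((∫ θ in (0 : ℝ)..(Real.pi / 2), Real.sin θ ^ (2 * n) : ℝ) : ℂ) = Real.pi / 2 * bc n := by
  induction n with
  | zero => simp [bc]
  | succ n ih =>
    rw [mul_add, mul_one, integral_sin_pow, bc_succ]
    simp only [Real.sin_zero, Real.cos_pi_div_two]
    push_cast at ih ⊢
    have hn1 : (n : ℂ) + 1 ≠ 0 := by exact_mod_cast n.succ_ne_zero
    have hn2 : 2 * (n : ℂ) + 2 ≠ 0 := by exact_mod_cast (2 * n + 1).succ_ne_zero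
    rw [← mul_assoc, ← ih]
    simp
    field_simp

lemma one_sub_mem_slitPlane_of_norm_lt {m : ℂ} (hm : ‖m‖ < 1) : 1 - m ∈ Complex.slitPlane := by
  refine Or.inl ?_
  have := (Complex.re_le_norm m).trans_lt hm
  simp; linarith

lemma norm_mul_sin_sq_lt {m : ℂ} (hm : ‖m‖ < 1) (θ : ℝ) : ‖m * (Real.sin θ : ℂ) ^ 2‖ < 1 := by
  rw [norm_mul, norm_pow, Complex.norm_real, Real.norm_eq_abs, sq_abs]
  nlinarith [Real.sin_sq_le_one θ, sq_nonneg (Real.sin θ), norm_nonneg m]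

/-- The binomial series is integrated termwise. Wallis's integrals supply a second factor `bc n`,
which is why the squares `hc n` appear. -/
lemma ellK_eq_F {m : ℂ} (hm : ‖m‖ < 1) : ellK m = Real.pi / 2 * F m := by
  rw [ellK_eq_integral (one_sub_mem_slitPlane_of_norm_lt hm)]
  have h := intervalIntegral.hasSum_integral_of_dominated_convergence (μ := volume)
    (a := 0) (b := Real.pi / 2)
    (F := fun (n : ℕ) (θ : ℝ) => bc n * (m * (Real.sin θ : ℂ) ^ 2) ^ n) (f := ellInt m)
    (fun n _ => ‖m‖ ^ n)
    (fun n => (by fun_prop : Continuous _).aestronglyMeasurable)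
    (fun n => Eventually.of_forall fun θ _ => by
      rw [norm_mul, norm_pow, norm_mul, norm_pow, Complex.norm_real, Real.norm_eq_abs, sq_abs]
      calc _ ≤ 1 * (‖m‖ * 1) ^ n := by
            gcongr
            · exact norm_bc_le n
            · exact Real.sin_sq_le_one θ
        _ = _ := by ring)
    (Eventually.of_forall fun θ _ => summable_geometric_of_lt_one (norm_nonneg m) hm)
    (by simp)
    (Eventually.of_forall fun θ _ => hasSum_inv_sqrt (norm_mul_sin_sq_lt hm θ))
  rw [← h.tsum_eq, F_eq_psum, psum, ← tsum_mul_left]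
  refine tsum_congr fun n => ?_
  have : ∀ θ : ℝ, bc n * (m * (Real.sin θ : ℂ) ^ 2) ^ n
      = bc n * m ^ n * ((Real.sin θ ^ (2 * n) : ℝ) : ℂ) := fun θ => by
    push_cast; rw [mul_pow, ← pow_mul]; ring
  simp only [this]
  rw [intervalIntegral.integral_const_mul, intervalIntegral.integral_ofReal,
    integral_sin_pow_two_mul, hc_eq_bc_sq]
  ring

/-- A principal power `z ^ (-1/2)` with `z` in the slit plane has argument in `(-π/2, π/2)`, so the
integrand of `K` has positive real part everywhere. -/
lemma re_F_pos {m : ℂ} (hm : ‖m‖ < 1) : 0 < (F m).re := by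
  have hpi := Real.pi_pos
  have hm' := one_sub_mem_slitPlane_of_norm_lt hm
  have h := ellK_eq_F hm
  rw [ellK_eq_integral hm'] at h
  have h2 := congrArg Complex.re h
  have h3 : (∫ θ in (0 : ℝ)..(Real.pi / 2), ellInt m θ).re
      = ∫ θ in (0 : ℝ)..(Real.pi / 2), (ellInt m θ).re :=
    (Complex.reCLM.intervalIntegral_comp_comm
      ((continuous_ellInt hm').intervalIntegrable _ _)).symm
  have h4 : 0 < ∫ θ in (0 : ℝ)..(Real.pi / 2), (ellInt m θ).re := by
    refine intervalIntegral.intervalIntegral_pos_of_pos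
      ((Complex.continuous_re.comp (continuous_ellInt hm')).intervalIntegrable _ _)
      (fun θ => ?_) (by positivity)
    have hz := one_sub_mul_sin_mem_slitPlane hm' θ
    rw [ellInt, Complex.cpow_def_of_ne_zero (Complex.slitPlane_ne_zero hz), Complex.exp_re]
    refine mul_pos (Real.exp_pos _) (Real.cos_pos_of_mem_Ioo ?_)
    have e : (Complex.log (1 - m * (Real.sin θ : ℂ) ^ 2) * -(1 / 2)).im
        = -(Complex.arg (1 - m * (Real.sin θ : ℂ) ^ 2)) / 2 := by
      rw [show (-(1 / 2) : ℂ) = ((-(1 / 2) : ℝ) : ℂ) by push_cast; rfl, Complex.im_mul_ofReal,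
        Complex.log_im]
      ring
    rw [e]
    have h5 := Complex.mem_slitPlane_iff_arg.1 hz
    have h6 := Complex.arg_le_pi (1 - m * (Real.sin θ : ℂ) ^ 2)
    have h7 := Complex.neg_pi_lt_arg (1 - m * (Real.sin θ : ℂ) ^ 2)
    constructor
    · have := lt_of_le_of_ne h6 h5.1
      linarith
    · linarith
  rw [h3] at h2
  rw [h2, show ((Real.pi : ℂ) / 2) = ((Real.pi / 2 : ℝ) : ℂ) by push_cast; rfl,
    Complex.re_ofReal_mul] at h4
  exact (mul_pos_iff_of_pos_left (by positivity)).1 h4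

lemma F_ne_zero {m : ℂ} (hm : ‖m‖ < 1) : F m ≠ 0 := fun h => by
  have := re_F_pos hm
  simp [h] at this

end PicardPoles
end

/-! ### Asymptotics of `K(1 - x)` as `x` decreases to `0`. -/

noncomputable section
namespace PicardPoles
open Filter Topology Set MeasureTheory
open scoped Interval

/-- `√(1 - (1 - x) sin² θ)`. -/
def rad (x θ : ℝ) : ℝ := √(1 - (1 - x) * Real.sin θ ^ 2)

lemma rad_arg_pos {x : ℝ} (h0 : 0 < x) (θ : ℝ) :
    0 < 1 - (1 - x) * Real.sin θ ^ 2 := by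
  rcases (sq_nonneg (Real.sin θ)).eq_or_lt with h | h
  · rw [← h]; norm_num
  · nlinarith [mul_pos h0 h, Real.sin_sq_le_one θ]

lemma rad_pos {x : ℝ} (h0 : 0 < x) (θ : ℝ) : 0 < rad x θ := Real.sqrt_pos.2 (rad_arg_pos h0 θ)

lemma continuous_inv_rad {x : ℝ} (h0 : 0 < x) :
    Continuous fun θ => (rad x θ)⁻¹ := by
  refine Continuous.inv₀ (by unfold rad; fun_prop) fun θ => (rad_pos h0 θ).ne'

lemma ellInt_one_sub_eq {x : ℝ} (h0 : 0 < x) (θ : ℝ) :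
    ellInt (1 - x) θ = ((rad x θ)⁻¹ : ℝ) := by
  have h := rad_arg_pos h0 θ
  rw [ellInt, rad, Real.sqrt_eq_rpow, ← Real.rpow_neg h.le, Complex.ofReal_cpow h.le]
  push_cast
  rfl

lemma ellK_one_sub_eq {x : ℝ} (h0 : 0 < x) :
    ellK (1 - x) = ((∫ θ in (0 : ℝ)..(Real.pi / 2), (rad x θ)⁻¹ : ℝ) : ℂ) := by
  rw [ellK_eq_integral (by simpa using h0), ← intervalIntegral.integral_ofReal]
  exact intervalIntegral.integral_congr fun θ _ => ellInt_one_sub_eq h0 θ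

/-- Splitting the numerator as `1 = sin θ + (1 - sin θ)` isolates the logarithmic singularity in the
first term, which has an elementary antiderivative. -/
lemma integral_sin_div_rad {x : ℝ} (h0 : 0 < x) (h1 : x < 1) :
    ∫ θ in (0 : ℝ)..(Real.pi / 2), Real.sin θ * (rad x θ)⁻¹
      = (√(1 - x))⁻¹ * (Real.log (1 + √(1 - x)) - Real.log x / 2) := by
  have hm : 0 < √(1 - x) := Real.sqrt_pos.2 (by linarith)
  have hsq : √(1 - x) ^ 2 = 1 - x := Real.sq_sqrt (by linarith)
  have hd : ∀ θ ∈ [[0, Real.pi / 2]], HasDerivAt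
      (fun θ => -(√(1 - x))⁻¹ * Real.log (√(1 - x) * Real.cos θ + rad x θ))
      (Real.sin θ * (rad x θ)⁻¹) θ := by
    intro θ hθ
    rw [uIcc_of_le (by positivity)] at hθ
    have hr := rad_pos h0 θ
    have hc : 0 ≤ Real.cos θ :=
      Real.cos_nonneg_of_mem_Icc ⟨by linarith [hθ.1, Real.pi_pos], hθ.2⟩
    have hpos : 0 < √(1 - x) * Real.cos θ + rad x θ := by positivity
    have e1 : HasDerivAt (fun θ => 1 - (1 - x) * Real.sin θ ^ 2)
        (-((1 - x) * (2 * Real.sin θ * Real.cos θ))) θ := by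
      have := (((Real.hasDerivAt_sin θ).pow 2).const_mul (1 - x)).const_sub 1
      simpa using this
    have e2 : HasDerivAt (rad x) (-((1 - x) * (2 * Real.sin θ * Real.cos θ)) / (2 * rad x θ)) θ :=
      e1.sqrt (rad_arg_pos h0 θ).ne'
    have e3 := ((((Real.hasDerivAt_cos θ).const_mul (√(1 - x))).add e2).log
      hpos.ne').const_mul (-(√(1 - x))⁻¹)
    refine e3.congr_deriv ?_
    simp only [Pi.add_apply]
    generalize √(1 - x) = m at hm hsq hpos ⊢
    rw [← hsq]
    field_simp
    ring
  rw [intervalIntegral.integral_eq_sub_of_hasDerivAt hd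
    ((Real.continuous_sin.mul (continuous_inv_rad h0)).intervalIntegrable _ _)]
  have r1 : rad x (Real.pi / 2) = √x := by simp [rad]
  have r0 : rad x 0 = 1 := by simp [rad]
  rw [r1, r0]
  simp only [Real.cos_pi_div_two, Real.cos_zero, mul_zero, zero_add, mul_one]
  rw [Real.log_sqrt h0.le, add_comm (√(1 - x)) 1]
  ring


lemma integral_cos_div_one_add_sin :
    ∫ θ in (0 : ℝ)..(Real.pi / 2), Real.cos θ / (1 + Real.sin θ) = Real.log 2 := by
  have hpos : ∀ θ ∈ [[0, Real.pi / 2]], 0 < 1 + Real.sin θ := fun θ hθ => by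
    rw [uIcc_of_le (by positivity)] at hθ
    have := Real.sin_nonneg_of_nonneg_of_le_pi hθ.1 (by linarith [hθ.2, Real.pi_pos])
    linarith
  have hd : ∀ θ ∈ [[0, Real.pi / 2]], HasDerivAt (fun θ => Real.log (1 + Real.sin θ))
      (Real.cos θ / (1 + Real.sin θ)) θ := fun θ hθ =>
    ((Real.hasDerivAt_sin θ).const_add 1).log (hpos θ hθ).ne'
  rw [intervalIntegral.integral_eq_sub_of_hasDerivAt hd]
  · norm_num
  · exact (ContinuousOn.div (by fun_prop) (by fun_prop) fun θ hθ =>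
      (hpos θ hθ).ne').intervalIntegrable

/-- The remaining part has no singularity in the limit: `(1 - s)² ≤ 1 - s² ≤ 1 - (1 - x)s²` for `0 ≤
s ≤ 1` bounds the integrand by `1`. For `x = 0` it becomes `cos θ/(1 + sin θ)`. -/
lemma tendsto_integral_one_sub_sin_div_rad :
    Tendsto (fun x : ℝ => ∫ θ in (0 : ℝ)..(Real.pi / 2), (1 - Real.sin θ) * (rad x θ)⁻¹)
      (𝓝[>] 0) (𝓝 (Real.log 2)) := by
  have hpi := Real.pi_pos
  rw [← integral_cos_div_one_add_sin]
  have hne : ∀ᵐ θ : ℝ, θ ≠ Real.pi / 2 := compl_mem_ae_iff.2 (measure_singleton _)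
  have key : ∀ θ ∈ Ι 0 (Real.pi / 2), θ ≠ Real.pi / 2 → 0 < Real.cos θ ∧ 0 ≤ Real.sin θ := by
    intro θ hθ h
    rw [uIoc_of_le (by positivity)] at hθ
    exact ⟨Real.cos_pos_of_mem_Ioo ⟨by linarith [hθ.1], lt_of_le_of_ne hθ.2 h⟩,
      Real.sin_nonneg_of_nonneg_of_le_pi hθ.1.le (by linarith [hθ.2])⟩
  refine intervalIntegral.tendsto_integral_filter_of_dominated_convergence (fun _ => 1) ?_ ?_ ?_ ?_
  · filter_upwards [self_mem_nhdsWithin] with x hx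
    exact ((continuous_const.sub Real.continuous_sin).mul
      (continuous_inv_rad hx)).aestronglyMeasurable
  · filter_upwards [self_mem_nhdsWithin] with x hx
    filter_upwards [hne] with θ h hθ
    obtain ⟨hc, hs⟩ := key θ hθ h
    have hs1 := Real.sin_le_one θ
    have hr := rad_pos hx θ
    rw [Real.norm_of_nonneg (mul_nonneg (by linarith) (inv_nonneg.2 hr.le)), ← div_eq_mul_inv,
      div_le_one hr]
    refine Real.le_sqrt_of_sq_le ?_
    have hx' : 0 < x := hx
    nlinarith [sq_nonneg (Real.sin θ)]
  · simp
  · filter_upwards [hne] with θ h hθ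
    obtain ⟨hc, hs⟩ := key θ hθ h
    have h2 := Real.sin_sq_add_cos_sq θ
    have e0 : rad 0 θ = Real.cos θ := by
      rw [rad, sub_zero, one_mul, show 1 - Real.sin θ ^ 2 = Real.cos θ ^ 2 by linarith,
        Real.sqrt_sq hc.le]
    have e : Real.cos θ / (1 + Real.sin θ) = (1 - Real.sin θ) * (rad 0 θ)⁻¹ := by
      rw [e0]
      field_simp
      linarith
    rw [e]
    have hcont : ContinuousAt (fun x => (1 - Real.sin θ) * (rad x θ)⁻¹) 0 := by
      refine continuousAt_const.mul (ContinuousAt.inv₀ ?_ (by rw [e0]; exact hc.ne'))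
      unfold rad
      fun_prop
    exact hcont.tendsto.mono_left nhdsWithin_le_nhds

lemma tendsto_ellK_one_sub :
    Tendsto (fun x : ℝ => (∫ θ in (0 : ℝ)..(Real.pi / 2), (rad x θ)⁻¹) + Real.log x / 2)
      (𝓝[>] 0) (𝓝 (Real.log 4)) := by
  have hlog : Real.log 4 = Real.log 2 + (Real.log 2 - 0) := by
    rw [show (4 : ℝ) = 2 * 2 by norm_num, Real.log_mul (by norm_num) (by norm_num), sub_zero]
  rw [hlog]
  -- the elementary part
  have hsqrt : Tendsto (fun x : ℝ => √(1 - x)) (𝓝[>] 0) (𝓝 1) := by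
    have : ContinuousAt (fun x : ℝ => √(1 - x)) 0 := by fun_prop
    simpa using this.tendsto.mono_left nhdsWithin_le_nhds
  have h1 : Tendsto (fun x : ℝ => (√(1 - x))⁻¹ * Real.log (1 + √(1 - x))) (𝓝[>] 0)
      (𝓝 (Real.log 2)) := by
    have := (hsqrt.inv₀ one_ne_zero).mul ((hsqrt.const_add 1).log (by norm_num))
    simpa [show (1 : ℝ) + 1 = 2 by norm_num] using this
  -- With `m = √(1 - x)` one has `m⁻¹ - 1 = x / (m(1 + m))`, which is `O(x)` and beats the
  -- logarithm.
  have h2 : Tendsto (fun x : ℝ => ((√(1 - x))⁻¹ - 1) * Real.log x / 2) (𝓝[>] 0) (𝓝 0) := by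
    have hxl : Tendsto (fun x : ℝ => Real.log x * x) (𝓝[>] 0) (𝓝 0) := by
      simpa using tendsto_log_mul_rpow_nhdsGT_zero (r := 1) one_pos
    have hg : Tendsto (fun x : ℝ => (√(1 - x))⁻¹ * (1 + √(1 - x))⁻¹ / 2) (𝓝[>] 0)
        (𝓝 (1⁻¹ * (1 + 1)⁻¹ / 2)) :=
      ((hsqrt.inv₀ one_ne_zero).mul ((hsqrt.const_add 1).inv₀ (by norm_num))).div_const 2
    have := hxl.mul hg
    rw [zero_mul] at this
    refine this.congr' ?_
    filter_upwards [Ioo_mem_nhdsGT (show (0 : ℝ) < 1 by norm_num)] with x hx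
    have hm : 0 < √(1 - x) := Real.sqrt_pos.2 (by linarith [hx.2])
    have hsq : √(1 - x) ^ 2 = 1 - x := Real.sq_sqrt (by linarith [hx.2])
    have hx' : x = (1 - √(1 - x)) * (1 + √(1 - x)) := by linarith
    have e : x * ((√(1 - x))⁻¹ * (1 + √(1 - x))⁻¹) = (√(1 - x))⁻¹ - 1 := by
      have : 1 + √(1 - x) ≠ 0 := by positivity
      field_simp
      linarith
    rw [← e]
    ring
  refine (tendsto_integral_one_sub_sin_div_rad.add (h1.sub h2)).congr' ?_
  filter_upwards [Ioo_mem_nhdsGT (show (0 : ℝ) < 1 by norm_num)] with x hx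
  have i1 := integral_sin_div_rad hx.1 hx.2
  have i2 : ∫ θ in (0 : ℝ)..(Real.pi / 2), (1 - Real.sin θ) * (rad x θ)⁻¹
      = (∫ θ in (0 : ℝ)..(Real.pi / 2), (rad x θ)⁻¹)
        - ∫ θ in (0 : ℝ)..(Real.pi / 2), Real.sin θ * (rad x θ)⁻¹ := by
    have hc := Real.continuous_sin.mul (continuous_inv_rad hx.1)
    simp only [Pi.mul_def] at hc
    rw [← intervalIntegral.integral_sub ((continuous_inv_rad hx.1).intervalIntegrable _ _)
      (hc.intervalIntegrable _ _)]
    exact intervalIntegral.integral_congr fun θ _ => by ring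
  rw [i2, i1]
  ring

end PicardPoles
end

/-! ### The connection formula and the half-periods on the covering. -/

noncomputable section
namespace PicardPoles
open Filter Topology Set

lemma F_zero : F 0 = 1 := by
  rw [F_eq_psum, psum, tsum_eq_single 0 fun n hn => by simp [hn]]
  simp [hc_zero]

lemma F₁_zero : F₁ 0 = -(Real.log 16 : ℂ) := by
  rw [F₁_eq_psum, psum, tsum_eq_single 0 fun n hn => by simp [hn]]
  simp [hb, hc_zero, hd_zero]

/-- The Wronskian identity for `F` and `F log x + F₁`. -/
lemma wronskian_eq_one {x : ℂ} (hx : ‖x‖ < 1) :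
    (1 - x) * F x ^ 2 + F x * (x * (1 - x) * dF₁ x) - x * (1 - x) * dF x * F₁ x = 1 := by
  -- The logarithms cancel in the Wronskian, so this expression is holomorphic at `0` too. There it
  -- equals `F(0)² = 1`, and the two differential equations make it constant.
  have hd : ∀ y ∈ Metric.ball (0 : ℂ) 1, HasDerivAt (fun x => (1 - x) * F x ^ 2
      + F x * (x * (1 - x) * dF₁ x) - x * (1 - x) * dF x * F₁ x) 0 y := by
    intro y hy
    have hy := mem_ball_zero_iff.1 hy
    have h1 : HasDerivAt (fun x : ℂ => 1 - x) (-1) y := (hasDerivAt_id y).const_sub 1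
    have hF := hasDerivAt_F hy
    have hF1 := hasDerivAt_F₁ hy
    have h := ((h1.mul (hF.pow 2)).add (hF.mul (hasDerivAt_mul_dF₁ hy))).sub
      ((hasDerivAt_mul_dF hy).mul hF1)
    refine h.congr_deriv ?_
    simp only [Pi.pow_apply]
    push_cast
    ring
  have := (convex_ball (0 : ℂ) 1).isPreconnected
  have h := Metric.isOpen_ball.is_const_of_deriv_eq_zero this
    (fun y hy => (hd y hy).differentiableAt.differentiableWithinAt) (fun y hy => (hd y hy).deriv)
    (mem_ball_zero_iff.2 hx) (Metric.mem_ball_self one_pos)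
  simpa [F_zero] using h

/-- The second solution `F log x + F₁` of the hypergeometric equation. -/
def U (x : ℂ) : ℂ := F x * Complex.log x + F₁ x

/-- `x (1 - x) U'(x)`. -/
def pU (x : ℂ) : ℂ :=
  x * (1 - x) * dF x * Complex.log x + (1 - x) * F x + x * (1 - x) * dF₁ x

lemma hasDerivAt_U {x : ℂ} (hx : ‖x‖ < 1) (hs : x ∈ Complex.slitPlane) :
    HasDerivAt U (dF x * Complex.log x + F x * x⁻¹ + dF₁ x) x :=
  ((hasDerivAt_F hx).mul (Complex.hasDerivAt_log hs)).add (hasDerivAt_F₁ hx)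

lemma hasDerivAt_pU {x : ℂ} (hx : ‖x‖ < 1) (hs : x ∈ Complex.slitPlane) :
    HasDerivAt pU (U x / 4) x := by
  have h1 : HasDerivAt (fun x : ℂ => 1 - x) (-1) x := (hasDerivAt_id x).const_sub 1
  have h := (((hasDerivAt_mul_dF hx).mul (Complex.hasDerivAt_log hs)).add
    (h1.mul (hasDerivAt_F hx))).add (hasDerivAt_mul_dF₁ hx)
  refine h.congr_deriv ?_
  have := Complex.slitPlane_ne_zero hs
  rw [U]
  field_simp
  ring

/-- The lens `|x| < 1`, `|1 - x| < 1`. -/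
def lens : Set ℂ := {x | ‖x‖ < 1 ∧ ‖1 - x‖ < 1}

lemma lens_eq : lens = Metric.ball 0 1 ∩ Metric.ball 1 1 := by
  ext x
  simp [lens, dist_eq_norm, norm_sub_rev]

lemma isOpen_lens : IsOpen lens := lens_eq ▸ Metric.isOpen_ball.inter Metric.isOpen_ball

lemma isPreconnected_lens : IsPreconnected lens :=
  lens_eq ▸ ((convex_ball (0 : ℂ) 1).inter (convex_ball (1 : ℂ) 1)).isPreconnected

lemma lens_subset_slitPlane {x : ℂ} (hx : x ∈ lens) : x ∈ Complex.slitPlane := by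
  have := one_sub_mem_slitPlane_of_norm_lt hx.2
  simpa using this

lemma ofReal_mem_lens {x : ℝ} (h0 : 0 < x) (h1 : x < 1) : (x : ℂ) ∈ lens := by
  refine ⟨?_, ?_⟩
  · rw [Complex.norm_real, Real.norm_of_nonneg h0.le]; exact h1
  · rw [← Complex.ofReal_one, ← Complex.ofReal_sub, Complex.norm_real,
      Real.norm_of_nonneg (by linarith)]
    linarith

/-- The coefficients are Wronskians: with `A(x) = F(1 - x)` and `p = x(1 - x)`, take `α = p(AU' -
A'U)` and `β = p(FA' - F'A)`. Both are constant on the connected lens since all three functions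
satisfy `(py')' = y/4`. Then `αF + βU = A · p(FU' - F'U) = A`. -/
lemma exists_F_one_sub_eq :
    ∃ α β : ℂ, ∀ x ∈ lens, F (1 - x) = α * F x + β * U x := by
  have hA : ∀ x ∈ lens, HasDerivAt (fun x => F (1 - x)) (-dF (1 - x)) x := fun x hx => by
    have h1 : HasDerivAt (fun x : ℂ => 1 - x) (-1) x := (hasDerivAt_id x).const_sub 1
    simpa [Function.comp_def] using (hasDerivAt_F hx.2).comp x h1
  have hpA : ∀ x ∈ lens, HasDerivAt (fun x => -((1 - x) * (1 - (1 - x)) * dF (1 - x)))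
      (F (1 - x) / 4) x := fun x hx => by
    have h1 : HasDerivAt (fun x : ℂ => 1 - x) (-1) x := (hasDerivAt_id x).const_sub 1
    refine (((hasDerivAt_mul_dF hx.2).comp x h1).neg).congr_deriv ?_
    ring
  have h1 : ∀ x ∈ lens, HasDerivAt (fun x => F (1 - x) * pU x
      - -((1 - x) * (1 - (1 - x)) * dF (1 - x)) * U x) 0 x := fun x hx => by
    have hs := lens_subset_slitPlane hx
    refine (((hA x hx).mul (hasDerivAt_pU hx.1 hs)).sub
      ((hpA x hx).mul (hasDerivAt_U hx.1 hs))).congr_deriv ?_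
    have := Complex.slitPlane_ne_zero hs
    rw [U, pU]
    field_simp
    ring
  have h2 : ∀ x ∈ lens, HasDerivAt (fun x => F x * -((1 - x) * (1 - (1 - x)) * dF (1 - x))
      - x * (1 - x) * dF x * F (1 - x)) 0 x := fun x hx => by
    refine (((hasDerivAt_F hx.1).mul (hpA x hx)).sub
      ((hasDerivAt_mul_dF hx.1).mul (hA x hx))).congr_deriv ?_
    ring
  have hc : ((1 / 2 : ℝ) : ℂ) ∈ lens := ofReal_mem_lens (by norm_num) (by norm_num)
  obtain ⟨α, k1⟩ : ∃ α, ∀ x ∈ lens, F (1 - x) * pU x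
      - -((1 - x) * (1 - (1 - x)) * dF (1 - x)) * U x = α := ⟨_, fun x hx => isOpen_lens.is_const_of_deriv_eq_zero isPreconnected_lens
    (fun y hy => (h1 y hy).differentiableAt.differentiableWithinAt)
    (fun y hy => (h1 y hy).deriv) hx hc⟩
  obtain ⟨β, k2⟩ : ∃ β, ∀ x ∈ lens, F x * -((1 - x) * (1 - (1 - x)) * dF (1 - x))
      - x * (1 - x) * dF x * F (1 - x) = β := ⟨_, fun x hx => isOpen_lens.is_const_of_deriv_eq_zero isPreconnected_lens
    (fun y hy => (h2 y hy).differentiableAt.differentiableWithinAt)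
    (fun y hy => (h2 y hy).deriv) hx hc⟩
  refine ⟨α, β, fun x hx => ?_⟩
  rw [← k1 x hx, ← k2 x hx]
  have hw := wronskian_eq_one hx.1
  simp only [U, pU]
  linear_combination (-F (1 - x)) * hw

/-- Here `U - ln x = (F - 1) ln x + F₁`. The first term vanishes in the limit because `F - 1` is
divisible by `x`. -/
lemma tendsto_U_sub_log :
    Tendsto (fun x : ℝ => U x - Real.log x) (𝓝[>] 0) (𝓝 (-(Real.log 16 : ℂ))) := by
  have hof : Tendsto (fun x : ℝ => (x : ℂ)) (𝓝[>] 0) (𝓝 0) := by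
    have : ContinuousAt (fun x : ℝ => (x : ℂ)) 0 := by fun_prop
    simpa using this.tendsto.mono_left nhdsWithin_le_nhds
  have hxl : Tendsto (fun x : ℝ => ((Real.log x * x : ℝ) : ℂ)) (𝓝[>] 0) (𝓝 0) := by
    have : Tendsto (fun x : ℝ => Real.log x * x) (𝓝[>] 0) (𝓝 0) := by
      simpa using tendsto_log_mul_rpow_nhdsGT_zero (r := 1) one_pos
    exact_mod_cast (Complex.continuous_ofReal.tendsto 0).comp this
  have hFd := (hasDerivAt_F (x := 0) (by simp)).differentiableAt
  have hds : Tendsto (fun x : ℝ => dslope F 0 (x : ℂ)) (𝓝[>] 0) (𝓝 (dslope F 0 0)) :=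
    (continuousAt_dslope_same.2 hFd).tendsto.comp hof
  have h1 : Tendsto (fun x : ℝ => F₁ (x : ℂ)) (𝓝[>] 0) (𝓝 (F₁ 0)) :=
    (hasDerivAt_F₁ (x := 0) (by simp)).continuousAt.tendsto.comp hof
  have h := (hds.mul hxl).add h1
  rw [mul_zero, zero_add, F₁_zero] at h
  refine h.congr' ?_
  filter_upwards [self_mem_nhdsWithin] with x hx
  have hx0 : (x : ℂ) ≠ 0 := by exact_mod_cast (ne_of_gt hx)
  have e := sub_smul_dslope F 0 (x : ℂ)
  rw [sub_zero, smul_eq_mul, F_zero] at e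
  rw [U, ← Complex.ofReal_log (le_of_lt hx)]
  push_cast
  linear_combination (Real.log x : ℂ) * e

lemma eq_zero_of_tendsto_mul_log {c l : ℂ}
    (h : Tendsto (fun x : ℝ => c * Real.log x) (𝓝[>] 0) (𝓝 l)) : c = 0 := by
  by_contra hc
  have h1 : Tendsto (fun x : ℝ => ‖c⁻¹ * (c * Real.log x)‖) (𝓝[>] 0) (𝓝 ‖c⁻¹ * l‖) :=
    (h.const_mul _).norm
  have h2 : Tendsto (fun x : ℝ => |Real.log x|) (𝓝[>] 0) atTop :=
    tendsto_abs_atBot_atTop.comp Real.tendsto_log_nhdsGT_zero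
  refine not_tendsto_nhds_of_tendsto_atTop h2 _ (h1.congr fun x => ?_)
  rw [inv_mul_cancel_left₀ hc, Complex.norm_real, Real.norm_eq_abs]

lemma F_one_sub_eq {x : ℂ} (hx : x ∈ lens) : Real.pi / 2 * F (1 - x) = -(1 / 2) * U x := by
  obtain ⟨α, β, h⟩ := exists_F_one_sub_eq
  have hpi : (Real.pi : ℂ) ≠ 0 := by exact_mod_cast Real.pi_ne_zero
  have hof : Tendsto (fun x : ℝ => (x : ℂ)) (𝓝[>] 0) (𝓝 0) := by
    have : ContinuousAt (fun x : ℝ => (x : ℂ)) 0 := by fun_prop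
    simpa using this.tendsto.mono_left nhdsWithin_le_nhds
  have hF : Tendsto (fun x : ℝ => F (x : ℂ)) (𝓝[>] 0) (𝓝 1) := by
    have := (hasDerivAt_F (x := 0) (by simp)).continuousAt.tendsto.comp hof
    rwa [F_zero] at this
  have hK : Tendsto (fun x : ℝ => Real.pi / 2 * (α * F x + β * U x) + Real.log x / 2)
      (𝓝[>] 0) (𝓝 (Real.log 4 : ℂ)) := by
    refine ((Complex.continuous_ofReal.tendsto _).comp tendsto_ellK_one_sub).congr' ?_
    filter_upwards [Ioo_mem_nhdsGT (show (0 : ℝ) < 1 by norm_num)] with x hx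
    have hl := ofReal_mem_lens hx.1 hx.2
    rw [← h x hl, ← ellK_eq_F hl.2, ellK_one_sub_eq hx.1]
    simp
  -- The difference is exactly `(πβ/2 + 1/2) ln x`. Its convergence forces that coefficient to be
  -- zero, and then the limit of the constant function determines `α`.
  have hsub := hK.sub (((hF.const_mul α).add (tendsto_U_sub_log.const_mul β)).const_mul
    (Real.pi / 2 : ℂ))
  have hβ : Real.pi / 2 * β + 1 / 2 = 0 := by
    refine eq_zero_of_tendsto_mul_log (hsub.congr fun x => ?_)
    ring
  have hα : (Real.log 4 : ℂ) - Real.pi / 2 * (α * 1 + β * -(Real.log 16 : ℂ)) = 0 := by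
    refine tendsto_nhds_unique hsub (tendsto_const_nhds.congr fun x => ?_)
    linear_combination (-(Real.log x : ℂ)) * hβ
  have hlog : (Real.log 16 : ℂ) = 2 * Real.log 4 := by
    rw [show (16 : ℝ) = 4 ^ 2 by norm_num, Real.log_pow]; push_cast; rfl
  -- The constants balance because `ln 16 = 2 ln 4`, so `F` itself does not occur in `F(1 - x)`.
  have hα0 : Real.pi / 2 * α = 0 := by
    rw [hlog] at hα
    linear_combination (-1) * hα + 2 * (Real.log 4 : ℂ) * hβ
  rw [h x hx]
  linear_combination F x * hα0 + U x * hβ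

/-- The cut unit disk. -/
def cutDisk : Set ℂ := Metric.ball 0 1 ∩ Complex.slitPlane

/-- On the lens both `K(1 - x)` and `U` have their series. The identity theorem extends the
equality, the cut disk being star-shaped about `1/2`. -/
lemma ellK_one_sub_eq_U {x : ℂ} (hx : x ∈ cutDisk) : ellK (1 - x) = -(1 / 2) * U x := by
  have hopen : IsOpen cutDisk := Metric.isOpen_ball.inter Complex.isOpen_slitPlane
  have hd1 : DifferentiableOn ℂ (fun x => ellK (1 - x)) cutDisk := by
    refine differentiableOn_ellK.comp (by fun_prop) fun y hy => ?_
    simpa using hy.2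
  have hd2 : DifferentiableOn ℂ (fun x => -(1 / 2) * U x) cutDisk := fun y hy =>
    ((hasDerivAt_U (mem_ball_zero_iff.1 hy.1) hy.2).differentiableAt.const_mul
      _).differentiableWithinAt
  have hc : ((1 / 2 : ℝ) : ℂ) ∈ lens := ofReal_mem_lens (by norm_num) (by norm_num)
  have hcut : ((1 / 2 : ℝ) : ℂ) ∈ cutDisk :=
    ⟨mem_ball_zero_iff.2 hc.1, lens_subset_slitPlane hc⟩
  have hstar : StarConvex ℝ ((1 / 2 : ℝ) : ℂ) cutDisk := by
    refine StarConvex.inter ((convex_ball (0 : ℂ) 1).starConvex hcut.1) ?_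
    exact Complex.starConvex_ofReal_slitPlane (by norm_num)
  have hpre : IsPreconnected cutDisk :=
    (hstar.isPathConnected hcut).isConnected.isPreconnected
  refine (hd1.analyticOnNhd hopen).eqOn_of_preconnected_of_eventuallyEq
    (hd2.analyticOnNhd hopen) hpre hcut ?_ hx
  filter_upwards [isOpen_lens.mem_nhds hc] with y hy
  rw [ellK_eq_F hy.2, F_one_sub_eq hy]

lemma norm_exp_lt_one {t : ℂ} (ht : t.re < 0) : ‖Complex.exp t‖ < 1 := by
  rw [Complex.norm_exp]; simpa using ht

lemma omega1_exp {t : ℂ} (ht : t.re < 0) : omega1 (Complex.exp t) = omega1Cov t :=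
  ellK_eq_F (norm_exp_lt_one ht)

lemma omega2_exp {t : ℂ} (ht : t.re < 0) (hi : |t.im| < Real.pi) :
    omega2 (Complex.exp t) = omega2Cov t := by
  have hi := abs_lt.1 hi
  have hlog : Complex.log (Complex.exp t) = t := Complex.log_exp hi.1 hi.2.le
  have hs : Complex.exp t ∈ Complex.slitPlane := by
    rw [Complex.mem_slitPlane_iff_arg, ← Complex.log_im, hlog]
    exact ⟨hi.2.ne, Complex.exp_ne_zero t⟩
  rw [omega2, ellK_one_sub_eq_U ⟨mem_ball_zero_iff.2 (norm_exp_lt_one ht), hs⟩, U, hlog,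
    omega2Cov]
  ring

lemma differentiableAt_F_exp {t : ℂ} (ht : t.re < 0) :
    DifferentiableAt ℂ (fun t => F (Complex.exp t)) t :=
  (hasDerivAt_F (norm_exp_lt_one ht)).differentiableAt.comp t Complex.differentiableAt_exp

lemma differentiableAt_F₁_exp {t : ℂ} (ht : t.re < 0) :
    DifferentiableAt ℂ (fun t => F₁ (Complex.exp t)) t :=
  (hasDerivAt_F₁ (norm_exp_lt_one ht)).differentiableAt.comp t Complex.differentiableAt_exp

lemma differentiableOn_omega1Cov : DifferentiableOn ℂ omega1Cov {t : ℂ | t.re < 0} :=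
  fun _ ht => ((differentiableAt_F_exp ht).const_mul _).differentiableWithinAt

lemma differentiableOn_omega2Cov : DifferentiableOn ℂ omega2Cov {t : ℂ | t.re < 0} :=
  fun _ ht => ((((differentiableAt_F_exp ht).mul differentiableAt_id).add
    (differentiableAt_F₁_exp ht)).const_mul _).differentiableWithinAt

end PicardPoles
end

/-! ### Strict Schwarz-Pick, fixed points, and Lagrange inversion. -/

noncomputable section
namespace PicardPoles
open Filter Topology Set Metric

section StrictSelfMap

open scoped ComplexConjugate

lemma norm_blaschke_sq (R : ℝ) (p a : ℂ) :
    ‖(R : ℂ) ^ 2 - conj p * a‖ ^ 2 - R ^ 2 * ‖a - p‖ ^ 2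
      = (R ^ 2 - ‖a‖ ^ 2) * (R ^ 2 - ‖p‖ ^ 2) := by
  simp only [Complex.sq_norm, Complex.normSq_apply]
  simp [pow_two]
  ring

lemma blaschke_ne_zero {R : ℝ} {p a : ℂ} (hp : ‖p‖ < R) (ha : ‖a‖ ≤ R) :
    (R : ℂ) ^ 2 - conj p * a ≠ 0 := by
  intro h
  have h1 : ‖(R : ℂ) ^ 2‖ = ‖conj p * a‖ := by rw [sub_eq_zero.1 h]
  rw [norm_mul, norm_pow, Complex.norm_conj, Complex.norm_real, Real.norm_eq_abs, sq_abs] at h1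
  have hR : 0 < R := (norm_nonneg p).trans_lt hp
  nlinarith [norm_nonneg a, norm_nonneg p, mul_le_mul_of_nonneg_left ha (norm_nonneg p)]

/-- The quotient compares the pseudo-hyperbolic distances of `g a, g p` and of `a, p`. By the
maximum principle it suffices to look at `|z| = R`, where `|R² - p̄z| = R|z - p|` while `|g z| < R`
makes the other inequality strict. Using `dslope` includes the point `a = p` and hence the
derivative. -/
lemma norm_dslope_blaschke_lt_one {g : ℂ → ℂ} {R : ℝ} (hg : DiffContOnCl ℂ g (ball 0 R))
    (hgR : ∀ a ∈ closedBall (0 : ℂ) R, ‖g a‖ < R) {p : ℂ} (hp : ‖p‖ < R) {a : ℂ} (ha : ‖a‖ < R) :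
    ‖dslope (fun a => (g a - g p) * (R ^ 2 - conj p * a) / (R ^ 2 - conj (g p) * g a)) p a‖ < 1 := by
  have hR : 0 < R := (norm_nonneg p).trans_lt hp
  have hpm : p ∈ ball (0 : ℂ) R := mem_ball_zero_iff.2 hp
  have hgp := hgR p (ball_subset_closedBall hpm)
  set h : ℂ → ℂ := fun a => (g a - g p) * (R ^ 2 - conj p * a) / (R ^ 2 - conj (g p) * g a) with hh
  have hden : ∀ a ∈ closedBall (0 : ℂ) R, (R : ℂ) ^ 2 - conj (g p) * g a ≠ 0 := fun a ha =>
    blaschke_ne_zero hgp (hgR a ha).le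
  have hnhd : ball (0 : ℂ) R ∈ 𝓝 p := isOpen_ball.mem_nhds hpm
  have hdh : DifferentiableOn ℂ h (ball 0 R) := by
    refine DifferentiableOn.div ((hg.differentiableOn.sub_const _).mul (by fun_prop))
      ((differentiableOn_const _).sub (hg.differentiableOn.const_mul _))
      fun a ha => hden a (ball_subset_closedBall ha)
  have hch : ContinuousOn h (closedBall 0 R) := by
    have := hg.continuousOn_ball
    refine ContinuousOn.div ((this.sub continuousOn_const).mul (by fun_prop))
      (continuousOn_const.sub (continuousOn_const.mul this)) hden
  have hk : DiffContOnCl ℂ (dslope h p) (ball 0 R) := by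
    refine ⟨(Complex.differentiableOn_dslope hnhd).2 hdh, ?_⟩
    rw [closure_ball _ hR.ne']
    exact (continuousOn_dslope (mem_of_superset hnhd ball_subset_closedBall)).2
      ⟨hch, hdh.differentiableAt hnhd⟩
  obtain ⟨z, hz, hmax⟩ := Complex.exists_mem_frontier_isMaxOn_norm isBounded_ball
    ⟨0, mem_ball_self hR⟩ hk
  rw [frontier_ball _ hR.ne', mem_sphere_zero_iff_norm] at hz
  rw [closure_ball _ hR.ne'] at hmax
  have hzm : z ∈ closedBall (0 : ℂ) R := by simp [hz]
  refine (hmax (mem_closedBall_zero_iff.2 ha.le)).trans_lt ?_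
  have hzp : z ≠ p := by rintro rfl; linarith
  have hhp : h p = 0 := by simp [hh]
  simp only [Function.comp_apply]
  rw [dslope_of_ne _ hzp, slope_def_field, hhp, sub_zero, hh]
  have e1 := norm_blaschke_sq R p z
  rw [hz, sub_self, zero_mul] at e1
  have e2 := norm_blaschke_sq R (g p) (g z)
  have hgz := hgR z hzm
  have hn1 : ‖(R : ℂ) ^ 2 - conj p * z‖ = R * ‖z - p‖ := by
    have : ‖(R : ℂ) ^ 2 - conj p * z‖ ^ 2 = (R * ‖z - p‖) ^ 2 := by linarith
    exact (pow_left_inj₀ (norm_nonneg _) (by positivity) two_ne_zero).1 this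
  have hn2 : R * ‖g z - g p‖ < ‖(R : ℂ) ^ 2 - conj (g p) * g z‖ := by
    refine lt_of_pow_lt_pow_left₀ 2 (norm_nonneg _) ?_
    have : 0 < (R ^ 2 - ‖g z‖ ^ 2) * (R ^ 2 - ‖g p‖ ^ 2) := by
      refine mul_pos ?_ ?_ <;> rw [sub_pos] <;> gcongr
    linarith
  have hzp' : 0 < ‖z - p‖ := norm_pos_iff.2 (sub_ne_zero.2 hzp)
  have hden' : 0 < ‖(R : ℂ) ^ 2 - conj (g p) * g z‖ := norm_pos_iff.2 (hden z hzm)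
  rw [norm_div, norm_div, norm_mul, hn1, div_div, div_lt_one (by positivity)]
  nlinarith

/-- A strict form of the Schwarz-Pick lemma. -/
lemma schwarzPick_strict {g : ℂ → ℂ} {R : ℝ} (hg : DiffContOnCl ℂ g (ball 0 R))
    (hgR : ∀ a ∈ closedBall (0 : ℂ) R, ‖g a‖ < R) {p q : ℂ} (hp : ‖p‖ < R) (hq : ‖q‖ < R)
    (hpq : q ≠ p) :
    ‖g q - g p‖ * ‖(R : ℂ) ^ 2 - conj p * q‖ < ‖q - p‖ * ‖(R : ℂ) ^ 2 - conj (g p) * g q‖ := by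
  have h := norm_dslope_blaschke_lt_one hg hgR hp hq
  have h1 : 0 < ‖q - p‖ := norm_pos_iff.2 (sub_ne_zero.2 hpq)
  have h2 : 0 < ‖(R : ℂ) ^ 2 - conj (g p) * g q‖ := norm_pos_iff.2
    (blaschke_ne_zero (hgR p (by simpa using hp.le)) (hgR q (by simpa using hq.le)).le)
  rw [dslope_of_ne _ hpq, slope_def_field] at h
  simp only [sub_self, zero_mul, zero_div, sub_zero] at h
  rw [norm_div, norm_div, norm_mul, div_div, div_lt_one (by positivity)] at h
  linarith

/-- A strict holomorphic self map of a closed disk has exactly one fixed point, and this fixed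
point is simple. -/
lemma exists_unique_fixedPoint {g : ℂ → ℂ} {R : ℝ} (hR : 0 < R)
    (hg : DiffContOnCl ℂ g (ball 0 R)) (hgR : ∀ a ∈ closedBall (0 : ℂ) R, ‖g a‖ < R) :
    ∃ p, ‖p‖ < R ∧ g p = p ∧ deriv g p ≠ 1 ∧ ∀ q, ‖q‖ < R → g q = q → q = p := by
  -- Existence by minimizing the pseudo-hyperbolic distance from `a` to `g a` over the closed disk.
  obtain ⟨p, hp, hgp⟩ : ∃ p, ‖p‖ < R ∧ g p = p := by
    have hden : ∀ a ∈ closedBall (0 : ℂ) R, ‖(R : ℂ) ^ 2 - conj (g a) * a‖ ≠ 0 := fun a ha =>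
      norm_ne_zero_iff.2 (blaschke_ne_zero (hgR a ha) (mem_closedBall_zero_iff.1 ha))
    have hc := hg.continuousOn_ball
    have hd : ContinuousOn (fun a => ‖g a - a‖ / ‖(R : ℂ) ^ 2 - conj (g a) * a‖)
        (closedBall 0 R) := by
      refine ContinuousOn.div (hc.sub continuousOn_id).norm (ContinuousOn.norm ?_) hden
      exact continuousOn_const.sub
        ((Complex.continuous_conj.comp_continuousOn hc).mul continuousOn_id)
    obtain ⟨p, hp, hmin⟩ := (isCompact_closedBall (0 : ℂ) R).exists_isMinOn ⟨0, by simp [hR.le]⟩ hd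
    have hp' := mem_closedBall_zero_iff.1 hp
    have h0 := hgR 0 (by simp [hR.le])
    have hpR : ‖p‖ < R := by
      -- On the boundary circle the minimized quantity equals `1/R`, whereas at `0` it is `|g 0|/R²
      -- < 1/R`. So the minimum is interior.
      refine lt_of_le_of_ne hp' fun h => ?_
      have h1 := hmin (show (0 : ℂ) ∈ closedBall 0 R by simp [hR.le])
      simp only [mem_ofPred_eq, sub_zero, mul_zero] at h1
      have e := norm_blaschke_sq R (g p) p
      rw [h, sub_self, zero_mul] at e
      have e1 : ‖(R : ℂ) ^ 2 - conj (g p) * p‖ = R * ‖p - g p‖ := by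
        have : ‖(R : ℂ) ^ 2 - conj (g p) * p‖ ^ 2 = (R * ‖p - g p‖) ^ 2 := by linarith
        exact (pow_left_inj₀ (norm_nonneg _) (by positivity) two_ne_zero).1 this
      have h3 : 0 < ‖p - g p‖ := norm_pos_iff.2 (sub_ne_zero.2 fun h' => by
        have := hgR p hp; rw [← h', h] at this; exact lt_irrefl _ this)
      rw [e1, norm_sub_rev, norm_pow, Complex.norm_real, Real.norm_of_nonneg hR.le,
        div_le_div_iff₀ (by positivity) (by positivity)] at h1
      nlinarith [mul_pos hR h3]
    refine ⟨p, hpR, ?_⟩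
    by_contra hne
    have hq := hgR p hp
    -- If `p` were not fixed, moving to `g p` would strictly decrease the distance.
    have h1 := schwarzPick_strict hg hgR hq hpR (Ne.symm hne)
    have h2 := hmin (show g p ∈ closedBall 0 R by simpa using hq.le)
    simp only [mem_ofPred_eq] at h2
    have d1 := hden p hp
    have d2 := hden (g p) (by simpa using hq.le)
    rw [div_le_div_iff₀ (by positivity) (by positivity)] at h2
    rw [norm_sub_rev, norm_sub_rev p] at h1
    linarith
  have key : ∀ q, ‖q‖ < R → g q = q → q = p := fun q hq hgq => by
    by_contra hne
    have h := schwarzPick_strict hg hgR hp hq hne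
    rw [hgp, hgq] at h
    exact lt_irrefl _ h
  refine ⟨p, hp, hgp, fun h1 => ?_, key⟩
  -- At a fixed point with `g' = 1` the Blaschke quotient would have derivative `1`, contradicting
  -- the strict bound at `a = p`.
  have h := norm_dslope_blaschke_lt_one hg hgR hp hp
  have hgd : HasDerivAt g 1 p := by
    rw [← h1]; exact (hg.differentiableAt isOpen_ball (mem_ball_zero_iff.2 hp)).hasDerivAt
  have hne := blaschke_ne_zero hp hp.le
  have hder : HasDerivAt (fun a => (g a - g p) * (R ^ 2 - conj p * a) /
      (R ^ 2 - conj (g p) * g a)) 1 p := by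
    have n1 : HasDerivAt (fun a => R ^ 2 - conj p * a) (-(conj p)) p := by
      simpa using ((hasDerivAt_id p).const_mul (conj p)).const_sub ((R : ℂ) ^ 2)
    have n2 : HasDerivAt (fun a => R ^ 2 - conj (g p) * g a) (-(conj (g p) * 1)) p :=
      (hgd.const_mul (conj (g p))).const_sub ((R : ℂ) ^ 2)
    refine (((hgd.sub_const (g p)).mul n1).div n2 (by rw [hgp]; exact hne)).congr_deriv ?_
    simp only [Pi.mul_apply]
    rw [hgp]
    field_simp
    ring
  rw [dslope_same, hder.deriv, norm_one] at h
  exact lt_irrefl _ h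

end StrictSelfMap

lemma hasSum_circleIntegral {f : ℕ → ℂ → ℂ} {c : ℂ} {R : ℝ} (hR : 0 ≤ R) {u : ℕ → ℝ}
    (hf : ∀ n, ContinuousOn (f n) (sphere c R)) (hu : Summable u)
    (hfu : ∀ n, ∀ z ∈ sphere c R, ‖f n z‖ ≤ u n) :
    HasSum (fun n => ∮ z in C(c, R), f n z) (∮ z in C(c, R), ∑' n, f n z) := by
  have h := (tendstoUniformlyOn_tsum hu hfu).tendsto_circleIntegral_of_continuousOn hR
    (Eventually.of_forall fun t => continuousOn_finsetSum t fun n _ => hf n)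
  refine h.congr fun t => ?_
  exact circleIntegral.integral_fun_sum fun n _ => (hf n).circleIntegrable hR

/-- **Lagrange inversion.** -/
theorem lagrange_inversion {φ : ℂ → ℂ} {R S : ℝ} (hR : 0 < R) (hRS : R < S)
    (hφ : DifferentiableOn ℂ φ (ball 0 S)) {x : ℂ} (hx : ∀ a : ℂ, ‖a‖ = R → ‖x * φ a‖ < R) :
    ∃ p, ‖p‖ < R ∧ p = x * φ p ∧ (∀ q, ‖q‖ < R → q = x * φ q → q = p) ∧
      HasSum (fun n : ℕ =>
        iteratedDeriv n (fun a => φ a ^ (n + 1)) 0 / ((n + 1).factorial : ℂ) * x ^ (n + 1)) p := by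
  set g : ℂ → ℂ := fun a => x * φ a with hgdef
  have hgS : DifferentiableOn ℂ g (ball 0 S) := hφ.const_mul x
  have hsub : closedBall (0 : ℂ) R ⊆ ball 0 S := closedBall_subset_ball hRS
  have hgcl : DiffContOnCl ℂ g (ball 0 R) :=
    (hgS.mono ((closure_ball_subset_closedBall).trans hsub)).diffContOnCl
  -- a uniform bound
  obtain ⟨z₀, hz₀, hmax⟩ := (isCompact_sphere (0 : ℂ) R).exists_isMaxOn
    (NormedSpace.sphere_nonempty.2 hR.le)
    ((hgS.continuousOn.mono (sphere_subset_closedBall.trans hsub)).norm)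
  set C := ‖g z₀‖ with hC
  have hCR : C < R := hx z₀ (mem_sphere_zero_iff_norm.1 hz₀)
  have hgC : ∀ a ∈ sphere (0 : ℂ) R, ‖g a‖ ≤ C := fun a ha => hmax ha
  have hgR : ∀ a ∈ closedBall (0 : ℂ) R, ‖g a‖ < R := fun a ha => by
    refine lt_of_le_of_lt ?_ hCR
    refine Complex.norm_le_of_forall_mem_frontier_norm_le isBounded_ball hgcl ?_
      (by rwa [closure_ball _ hR.ne'])
    rw [frontier_ball _ hR.ne']
    exact hgC
  obtain ⟨p, hp, hgp, hder, huniq⟩ := exists_unique_fixedPoint hR hgcl hgR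
  refine ⟨p, hp, hgp.symm, fun q hq hgq => huniq q hq hgq.symm, ?_⟩
  have hpS : ball (0 : ℂ) S ∈ 𝓝 p := isOpen_ball.mem_nhds (by simpa using hp.trans hRS)
  have hgd : ∀ a ∈ ball (0 : ℂ) S, HasDerivAt g (deriv g a) a := fun a ha =>
    (hgS.differentiableAt (isOpen_ball.mem_nhds ha)).hasDerivAt
  have hsph : sphere (0 : ℂ) R ⊆ ball 0 S := sphere_subset_closedBall.trans hsub
  have hsne : ∀ a ∈ sphere (0 : ℂ) R, a ≠ 0 := fun a ha h => by
    rw [h, mem_sphere_zero_iff_norm, norm_zero] at ha; linarith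
  have cg : ContinuousOn g (sphere 0 R) := hgS.continuousOn.mono hsph
  have cg' : ContinuousOn (deriv g) (sphere 0 R) :=
    ((hgS.deriv isOpen_ball).continuousOn).mono hsph
  have cq : ContinuousOn (fun a => g a / a) (sphere 0 R) := cg.div continuousOn_id hsne
  have hq : ∀ a ∈ sphere (0 : ℂ) R, ‖g a / a‖ ≤ C / R := fun a ha => by
    rw [norm_div, mem_sphere_zero_iff_norm.1 ha]
    exact div_le_div_of_nonneg_right (hgC a ha) hR.le
  have hC0 : 0 ≤ C := norm_nonneg _
  have hq0 : 0 ≤ C / R := div_nonneg hC0 hR.le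
  have hq1 : C / R < 1 := (div_lt_one hR).2 hCR
  -- the integral of `a h' / h`, `h = a - g a`
  have hint : ∮ a in C(0, R), a * (1 - deriv g a) / (a - g a) = 2 * Real.pi * Complex.I * p := by
    set h : ℂ → ℂ := fun a => a - g a with hh
    have hhS : DifferentiableOn ℂ h (ball 0 S) := differentiableOn_id.sub hgS
    -- Dividing out the only zero, `h = (a - p) h₁`, gives `a h'/h = a/(a - p) + a h₁'/h₁`. Cauchy's
    -- formula evaluates the first integral to `2πi p`. The second vanishes because `h₁` has no zero
    -- on the closed disk, which at `a = p` is the simplicity of the fixed point.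
    set h₁ := dslope h p with hh₁
    have hh₁S : DifferentiableOn ℂ h₁ (ball 0 S) := (Complex.differentiableOn_dslope hpS).2 hhS
    have hhp : h p = 0 := sub_eq_zero.2 hgp.symm
    have hfac : ∀ a, h a = (a - p) * h₁ a := fun a => by
      have := sub_smul_dslope h p a
      rw [hhp, sub_zero, smul_eq_mul] at this
      exact this.symm
    have hh₁0 : ∀ a ∈ closedBall (0 : ℂ) R, h₁ a ≠ 0 := by
      intro a ha h0
      by_cases hap : a = p
      · subst hap
        rw [hh₁, dslope_same] at h0
        have hd : HasDerivAt h (1 - deriv g a) a :=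
          (hasDerivAt_id a).sub (hgd a (hsub ha))
        rw [hd.deriv, sub_eq_zero] at h0
        exact hder h0.symm
      · have h2 := hfac a
        rw [h0, mul_zero] at h2
        have h3 : g a = a := (sub_eq_zero.1 h2).symm
        have := hgR a ha
        rw [h3] at this
        exact hap (huniq a this h3)
    have hcl := closure_ball_subset_closedBall (x := (0 : ℂ)) (ε := R)
    have i1 : ∮ a in C(0, R), (a - p)⁻¹ • a = (2 * Real.pi * Complex.I : ℂ) • p :=
      (differentiable_id.diffContOnCl (s := ball (0 : ℂ) R)).circleIntegral_sub_inv_smul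
        (mem_ball_zero_iff.2 hp)
    have d2 : DifferentiableOn ℂ (fun a => a * deriv h₁ a / h₁ a) (closedBall 0 R) :=
      (differentiableOn_id.mul ((hh₁S.deriv isOpen_ball).mono hsub)).div (hh₁S.mono hsub) hh₁0
    have i2 : ∮ a in C(0, R), a * deriv h₁ a / h₁ a = 0 :=
      (d2.mono hcl).diffContOnCl.circleIntegral_eq_zero hR.le
    have hne : ∀ a ∈ sphere (0 : ℂ) R, a - p ≠ 0 := fun a ha h' => by
      rw [sub_eq_zero] at h'
      rw [h', mem_sphere_zero_iff_norm] at ha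
      linarith
    have ci1 : CircleIntegrable (fun a => (a - p)⁻¹ • a) 0 R :=
      (((continuousOn_id.sub continuousOn_const).inv₀ hne).smul
        continuousOn_id).circleIntegrable hR.le
    have ci2 : CircleIntegrable (fun a => a * deriv h₁ a / h₁ a) 0 R :=
      (d2.continuousOn.mono sphere_subset_closedBall).circleIntegrable hR.le
    have hsum := circleIntegral.integral_add ci1 ci2
    rw [i1, i2, add_zero, smul_eq_mul] at hsum
    rw [← hsum]
    refine circleIntegral.integral_congr hR.le fun a ha => ?_
    have haS := hsph ha
    have e1 : deriv h a = 1 - deriv g a := ((hasDerivAt_id a).sub (hgd a haS)).deriv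
    have e2 : deriv h a = h₁ a + (a - p) * deriv h₁ a := by
      have k1 : HasDerivAt (fun a => (a - p) * h₁ a) (1 * h₁ a + (a - p) * deriv h₁ a) a :=
        ((hasDerivAt_id a).sub_const p).mul
          (hh₁S.differentiableAt (isOpen_ball.mem_nhds haS)).hasDerivAt
      rw [one_mul] at k1
      rw [← k1.deriv]
      congr 1
      exact funext hfac
    have n1 := hne a ha
    have n2 := hh₁0 a (sphere_subset_closedBall ha)
    have e3 : a - g a = (a - p) * h₁ a := hfac a
    simp only [smul_eq_mul]
    rw [e3, ← e1, e2]
    field_simp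
  -- its expansion
  set c : ℕ → ℂ := fun n => ∮ a in C(0, R), (g a / a) ^ n with hc
  have hc0 : c 0 = 0 := by
    simpa [hc] using (differentiable_const (1 : ℂ)).diffContOnCl.circleIntegral_eq_zero hR.le
  have hcs : Summable c := by
    refine Summable.of_norm_bounded (g := fun n => 2 * Real.pi * R * (C / R) ^ n)
      ((summable_geometric_of_lt_one hq0 hq1).mul_left _) fun n => ?_
    refine circleIntegral.norm_integral_le_of_norm_le_const hR.le fun a ha => ?_
    rw [norm_pow]
    exact pow_le_pow_left₀ (norm_nonneg _) (hq a ha) n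
  have hT : ∀ n : ℕ, ∮ a in C(0, R), (1 - deriv g a) * (g a / a) ^ n
      = c n - n / (n + 1) * c (n + 1) := by
    intro n
    have hn1 : (n : ℂ) + 1 ≠ 0 := by exact_mod_cast n.succ_ne_zero
    have ci1 : CircleIntegrable (fun a => (g a / a) ^ n) 0 R := (cq.pow n).circleIntegrable hR.le
    have ci2 : CircleIntegrable (fun a => deriv g a * (g a / a) ^ n) 0 R :=
      (cg'.mul (cq.pow n)).circleIntegrable hR.le
    have ci3 : CircleIntegrable (fun a => (g a / a) ^ (n + 1)) 0 R :=
      (cq.pow (n + 1)).circleIntegrable hR.le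
    -- The integrand is the exact derivative of `g^(n+1) / ((n+1) aⁿ)`. This trades `g'` for a
    -- higher power of `g/a`.
    have hz : ∮ a in C(0, R), (deriv g a * (g a / a) ^ n - n / (n + 1) * (g a / a) ^ (n + 1))
        = 0 := by
      refine circleIntegral.integral_eq_zero_of_hasDerivWithinAt hR.le
        (f := fun a => (n + 1 : ℂ)⁻¹ * (g a ^ (n + 1) / a ^ n)) fun a ha => ?_
      have ha0 := hsne a ha
      have k := ((((hgd a (hsph ha)).pow (n + 1)).div ((hasDerivAt_id a).pow n)
        (pow_ne_zero n ha0)).const_mul (n + 1 : ℂ)⁻¹).hasDerivWithinAt (s := sphere 0 R)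
      refine k.congr_deriv ?_
      simp only [Pi.pow_apply, id_eq]
      push_cast
      cases n with
      | zero => simp
      | succ n =>
        simp only [add_tsub_cancel_right]
        push_cast at hn1 ⊢
        simp only [div_pow]
        field_simp
        ring
    have hconst : ∮ a in C(0, R), (n / (n + 1) : ℂ) * (g a / a) ^ (n + 1)
        = n / (n + 1) * c (n + 1) := circleIntegral.integral_const_mul _ _ _ _
    have ci4 : CircleIntegrable (fun a => (n / (n + 1) : ℂ) * (g a / a) ^ (n + 1)) 0 R :=
      ((continuousOn_const.mul (cq.pow (n + 1)))).circleIntegrable hR.le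
    rw [circleIntegral.integral_sub ci2 ci4, hconst, sub_eq_zero] at hz
    rw [← hz, hc, ← circleIntegral.integral_sub ci1 ci2]
    refine circleIntegral.integral_congr hR.le fun a _ => ?_
    ring
  obtain ⟨M, hM⟩ := (isCompact_sphere (0 : ℂ) R).exists_bound_of_continuousOn
    (continuousOn_const.sub cg' : ContinuousOn (fun a => 1 - deriv g a) (sphere 0 R))
  have hser := hasSum_circleIntegral (c := 0) (f := fun n a => (1 - deriv g a) * (g a / a) ^ n) hR.le
    (u := fun n => M * (C / R) ^ n) (fun n => (continuousOn_const.sub cg').mul (cq.pow n))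
    ((summable_geometric_of_lt_one hq0 hq1).mul_left _) (fun n a ha => by
      rw [norm_mul, norm_pow]
      have h1 := hM a ha
      have h2 := hq a ha
      have : 0 ≤ M := (norm_nonneg _).trans h1
      gcongr
      exact h1)
  have hval : ∮ a in C(0, R), ∑' n : ℕ, (1 - deriv g a) * (g a / a) ^ n
      = 2 * Real.pi * Complex.I * p := by
    rw [← hint]
    refine circleIntegral.integral_congr hR.le fun a ha => ?_
    have ha0 := hsne a ha
    have hlt : ‖g a / a‖ < 1 := (hq a ha).trans_lt hq1
    have hne : a - g a ≠ 0 := fun h' => by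
      rw [← sub_eq_zero.1 h', div_self ha0, norm_one] at hlt
      exact lt_irrefl _ hlt
    have hne2 : 1 - g a / a ≠ 0 := by
      rw [one_sub_div ha0]; exact div_ne_zero hne ha0
    rw [tsum_mul_left, tsum_geometric_of_norm_lt_one hlt]
    field_simp
  rw [hval] at hser
  simp only [hT] at hser
  have hpi : (2 * Real.pi * Complex.I : ℂ) ≠ 0 := Complex.two_pi_I_ne_zero
  -- As `c 0 = 0`, the shifted series has the same sum. Subtracting the null series with terms `c n
  -- - c (n + 1)` leaves the terms `c (n + 1)/(n + 1)`, which are Lagrange's by Cauchy's formula for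
  -- derivatives.
  have hsh : HasSum (fun n => c (n + 1)) (∑' n, c n) := by
    have := (hasSum_nat_add_iff' (f := c) 1).2 hcs.hasSum
    simpa [hc0] using this
  have hfin := ((hser.sub (hcs.hasSum.sub hsh)).div_const (2 * Real.pi * Complex.I : ℂ))
  rw [sub_self, sub_zero, mul_div_cancel_left₀ _ hpi] at hfin
  have e : ∀ n : ℕ, (c n - n / (n + 1) * c (n + 1) - (c n - c (n + 1))) / (2 * Real.pi * Complex.I)
      = iteratedDeriv n (fun a => φ a ^ (n + 1)) 0 / ((n + 1).factorial : ℂ) * x ^ (n + 1) := by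
    intro n
    have hd : DifferentiableOn ℂ (fun a => φ a ^ (n + 1)) (closedBall 0 R) :=
      (hφ.mono hsub).pow (n + 1)
    have h1 := hd.circleIntegral_one_div_sub_center_pow_smul hR n
    have h2 : c (n + 1) = x ^ (n + 1) *
        ∮ a in C(0, R), (1 / (a - 0) ^ (n + 1)) • φ a ^ (n + 1) := by
      rw [← circleIntegral.integral_const_mul]
      refine circleIntegral.integral_congr hR.le fun a _ => ?_
      simp only [hgdef, sub_zero, smul_eq_mul]
      rw [div_pow, mul_pow]
      ring
    rw [h1, smul_eq_mul] at h2
    have hn1 : (n : ℂ) + 1 ≠ 0 := by exact_mod_cast n.succ_ne_zero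
    have hn : (n.factorial : ℂ) ≠ 0 := by exact_mod_cast n.factorial_ne_zero
    rw [h2, Nat.factorial_succ]
    push_cast
    have hI := Complex.I_ne_zero
    have hpi' : (Real.pi : ℂ) ≠ 0 := by exact_mod_cast Real.pi_ne_zero
    field_simp
    ring
  simpa only [e] using hfin

end PicardPoles
end

/-! ### Taylor coefficients of Lagrange's series. -/

noncomputable section
namespace PicardPoles
open Filter Topology Set Metric

/-- The `n`-th Taylor coefficient at `0`. -/
def tc (f : ℂ → ℂ) (n : ℕ) : ℂ := iteratedDeriv n f 0 / n.factorial

lemma tc_congr {f g : ℂ → ℂ} (h : f =ᶠ[𝓝 0] g) (n : ℕ) : tc f n = tc g n := by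
  rw [tc, tc, h.iteratedDeriv_eq n]

lemma tc_zero (f : ℂ → ℂ) : tc f 0 = f 0 := by simp [tc]

lemma tc_mul {f g : ℂ → ℂ} (hf : AnalyticAt ℂ f 0) (hg : AnalyticAt ℂ g 0) (n : ℕ) :
    tc (fun x => f x * g x) n = ∑ i ∈ Finset.range (n + 1), tc f i * tc g (n - i) := by
  have h := iteratedDeriv_mul (n := n) (x := (0 : ℂ)) hf.contDiffAt hg.contDiffAt
  rw [tc]
  have e : (fun x => f x * g x) = f * g := rfl
  rw [e, h, Finset.sum_div]
  refine Finset.sum_congr rfl fun i hi => ?_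
  have hin : i ≤ n := Nat.lt_succ_iff.1 (Finset.mem_range.1 hi)
  rw [tc, tc, Nat.choose_eq_factorial_div_factorial hin,
    Nat.cast_div (Nat.factorial_mul_factorial_dvd_factorial hin)
      (by exact_mod_cast (Nat.mul_pos i.factorial_pos (n - i).factorial_pos).ne')]
  have h1 : (i.factorial : ℂ) ≠ 0 := by exact_mod_cast i.factorial_ne_zero
  have h2 : ((n - i).factorial : ℂ) ≠ 0 := by exact_mod_cast (n - i).factorial_ne_zero
  have h3 : (n.factorial : ℂ) ≠ 0 := by exact_mod_cast n.factorial_ne_zero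
  push_cast
  field_simp

lemma tc_deriv (f : ℂ → ℂ) (n : ℕ) : tc (deriv f) n = (n + 1) * tc f (n + 1) := by
  have h3 : (n.factorial : ℂ) ≠ 0 := by exact_mod_cast n.factorial_ne_zero
  have hn1 : (n : ℂ) + 1 ≠ 0 := by exact_mod_cast n.succ_ne_zero
  rw [tc, tc, iteratedDeriv_succ', Nat.factorial_succ]
  push_cast
  field_simp

lemma tc_const_mul (c : ℂ) (f : ℂ → ℂ) (n : ℕ) :
    tc (fun x => c * f x) n = c * tc f n := by
  rw [tc, tc, iteratedDeriv_const_mul_field, mul_div_assoc]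

lemma tc_one_sub_X : tc (fun x => 1 - x) 0 = 1 ∧ tc (fun x => 1 - x) 1 = -1 ∧
    ∀ n, tc (fun x => 1 - x) (n + 2) = 0 := by
  have hd : deriv (fun x : ℂ => 1 - x) = fun _ => -1 := by
    funext x
    exact ((hasDerivAt_id x).const_sub 1).deriv
  refine ⟨by simp [tc], ?_, fun n => ?_⟩
  · simp [tc]
  · rw [tc, iteratedDeriv_succ', hd, iteratedDeriv_const]
    simp

lemma tc_X : tc (fun x => x) 0 = 0 ∧ tc (fun x => x) 1 = 1 ∧ ∀ n, tc (fun x => x) (n + 2) = 0 := by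
  have hd : deriv (fun x : ℂ => x) = fun _ => 1 := by
    funext x
    exact (hasDerivAt_id x).deriv
  refine ⟨by simp [tc], ?_, fun n => ?_⟩
  · simp [tc]
  · rw [tc, iteratedDeriv_succ', hd, iteratedDeriv_const]
    simp

lemma tc_X_mul {f : ℂ → ℂ} (hf : AnalyticAt ℂ f 0) (n : ℕ) :
    tc (fun x => x * f x) (n + 1) = tc f n := by
  have ha : AnalyticAt ℂ (fun x : ℂ => x) 0 := analyticAt_id
  rw [tc_mul ha hf, Finset.sum_eq_single 1]
  · have := tc_X.2.1
    simp [this]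
  · intro i _ hi
    rcases i with _ | _ | i
    · have := tc_X.1
      simp [this]
    · exact absurd rfl hi
    · have := tc_X.2.2 i
      simp [this]
  · simp

lemma tc_one_sub_X_mul {f : ℂ → ℂ} (hf : AnalyticAt ℂ f 0) (n : ℕ) :
    tc (fun x => (1 - x) * f x) (n + 1) = tc f (n + 1) - tc f n := by
  have ha : AnalyticAt ℂ (fun x : ℂ => 1 - x) 0 := analyticAt_const.sub analyticAt_id
  rw [tc_mul ha hf, Finset.sum_range_succ', Finset.sum_eq_single_of_mem 0 (by simp)]
  · rw [zero_add, tc_one_sub_X.1, tc_one_sub_X.2.1]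
    simp
    ring
  · intro i _ hi
    obtain ⟨i, rfl⟩ := Nat.exists_eq_succ_of_ne_zero hi
    rw [tc_one_sub_X.2.2 i, zero_mul]

lemma tc_psum {a : ℕ → ℂ} (h : PolyBdd a) (n : ℕ) : tc (psum a) n = a n := by
  induction n generalizing a with
  | zero =>
    rw [tc_zero, psum, tsum_eq_single 0 fun n hn => by simp [hn]]
    simp
  | succ n ih =>
    have hn1 : (n : ℂ) + 1 ≠ 0 := by exact_mod_cast n.succ_ne_zero
    have h1 := tc_deriv (psum a) n
    have h2 : deriv (psum a) =ᶠ[𝓝 0] psum (dcoef a) := by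
      filter_upwards [isOpen_ball.mem_nhds (mem_ball_self (x := (0 : ℂ)) one_pos)] with x hx
      exact (h.hasDerivAt (mem_ball_zero_iff.1 hx)).deriv
    rw [tc_congr h2, ih h.dcoef, dcoef] at h1
    exact (mul_left_cancel₀ hn1 h1).symm

lemma analyticAt_F : AnalyticAt ℂ F 0 :=
  differentiableOn_F.analyticAt (isOpen_ball.mem_nhds (mem_ball_self one_pos))

/-- The function `(1 - x) F(x)²`. -/
def wF (x : ℂ) : ℂ := (1 - x) * (F x * F x)

lemma analyticAt_wF : AnalyticAt ℂ wF 0 :=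
  (analyticAt_const.sub analyticAt_id).mul (analyticAt_F.mul analyticAt_F)

lemma tc_F_values : tc F 0 = 1 ∧ tc F 1 = 1 / 4 ∧ tc F 2 = 9 / 64 ∧ tc F 3 = 25 / 256 ∧
    tc F 4 = 1225 / 16384 ∧ tc F 5 = 3969 / 65536 ∧ tc F 6 = 53361 / 1048576 := by
  have h := fun n => tc_psum polyBdd_hc n
  rw [← F_eq_psum] at h
  simp only [h]
  have h0 := hc_zero
  have h1 := hc_succ 0
  have h2 := hc_succ 1
  have h3 := hc_succ 2
  have h4 := hc_succ 3
  have h5 := hc_succ 4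
  have h6 := hc_succ 5
  norm_num at h1 h2 h3 h4 h5 h6
  rw [h0] at h1
  rw [h1] at h2
  rw [h2] at h3
  rw [h3] at h4
  rw [h4] at h5
  rw [h5] at h6
  refine ⟨h0, ?_, ?_, ?_, ?_, ?_, ?_⟩
  · rw [h1]; norm_num
  · rw [h2]; norm_num
  · rw [h3]; norm_num
  · rw [h4]; norm_num
  · rw [h5]; norm_num
  · rw [h6]; norm_num

lemma tc_wF_values : tc wF 0 = 1 ∧ tc wF 1 = -1 / 2 ∧ tc wF 2 = -5 / 32 ∧ tc wF 3 = -5 / 64 ∧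
    tc wF 4 = -389 / 8192 ∧ tc wF 5 = -527 / 16384 ∧ tc wF 6 = -6121 / 262144 := by
  obtain ⟨f0, f1, f2, f3, f4, f5, f6⟩ := tc_F_values
  have hA := fun n => tc_mul analyticAt_F analyticAt_F n
  have hs := fun n => tc_one_sub_X_mul (analyticAt_F.mul analyticAt_F) n
  have hs0 : tc wF 0 = 1 := by rw [tc_zero, wF, F_zero]; norm_num
  have hs' : ∀ n, tc wF (n + 1) = tc (fun x => F x * F x) (n + 1) - tc (fun x => F x * F x) n := hs
  refine ⟨hs0, ?_, ?_, ?_, ?_, ?_, ?_⟩ <;>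
  · rw [hs', hA, hA]
    simp only [Finset.sum_range_succ, Finset.sum_range_zero, f0, f1, f2, f3, f4, f5, f6,
      Nat.sub_self, Nat.reduceSub, Nat.reduceAdd, Nat.sub_zero, zero_add]
    norm_num

lemma hasDerivAt_phi {x : ℂ} (hx : ‖x‖ < 1) :
    HasDerivAt phi (phi x * -((dF₁ x * F x - F₁ x * dF x) / F x ^ 2)) x := by
  have h := ((((hasDerivAt_F₁ hx).div (hasDerivAt_F hx) (F_ne_zero hx)).neg).cexp).const_mul
    (1 / 16 : ℂ)
  refine h.congr_deriv ?_
  simp only [phi, Pi.neg_apply, Pi.div_apply]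
  ring

lemma differentiableOn_phi : DifferentiableOn ℂ phi (ball 0 1) := fun _ hx =>
  (hasDerivAt_phi (mem_ball_zero_iff.1 hx)).differentiableAt.differentiableWithinAt

lemma phi_zero : phi 0 = 1 := by
  rw [phi, F_zero, F₁_zero, div_one, neg_neg, ← Complex.ofReal_exp,
    Real.exp_log (by norm_num : (0 : ℝ) < 16)]
  norm_num

/-- The Wronskian identity reads `x w (F₁/F)' = 1 - w` with `w = (1 - x)F²`. As `φ'/φ = -(F₁/F)'`,
every power of `φ` satisfies a linear first-order equation whose only data are the rational
coefficients of `F`. -/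
lemma wF_mul_deriv_phi_pow (m : ℕ) {x : ℂ} (hx : ‖x‖ < 1) :
    x * (wF x * deriv (fun a => phi a ^ (m + 1)) x)
      = (m + 1) * (wF x * phi x ^ (m + 1)) - (m + 1) * phi x ^ (m + 1) := by
  have hF := F_ne_zero hx
  have hw := wronskian_eq_one hx
  have hd := (hasDerivAt_phi hx).fun_pow (m + 1)
  rw [hd.deriv, wF]
  simp only [add_tsub_cancel_right]
  push_cast
  field_simp
  rw [pow_succ]
  linear_combination (-(phi x ^ m * phi x)) * hw

/-- Comparison of the coefficients of `x^(n+1)`. Since `w(0) = 1`, the unknown top coefficient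
cancels on the right and the relation is a genuine recursion. -/
lemma tc_phi_pow_rec (m n : ℕ) :
    ∑ i ∈ Finset.range (n + 1), tc wF i * (((n - i : ℕ) + 1) * tc (fun a => phi a ^ (m + 1)) (n - i + 1))
      = (m + 1) * (∑ i ∈ Finset.range (n + 1 + 1), tc wF i * tc (fun a => phi a ^ (m + 1)) (n + 1 - i)
        - tc (fun a => phi a ^ (m + 1)) (n + 1)) := by
  have hphi : AnalyticAt ℂ phi 0 :=
    differentiableOn_phi.analyticAt (isOpen_ball.mem_nhds (mem_ball_self one_pos))
  have hψ : AnalyticAt ℂ (fun a => phi a ^ (m + 1)) 0 := hphi.fun_pow (m + 1)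
  have hev : (fun x => x * (wF x * deriv (fun a => phi a ^ (m + 1)) x)) =ᶠ[𝓝 0]
      fun x => (m + 1 : ℂ) * ((wF x - 1) * phi x ^ (m + 1)) := by
    filter_upwards [isOpen_ball.mem_nhds (mem_ball_self (x := (0 : ℂ)) one_pos)] with x hx
    rw [wF_mul_deriv_phi_pow m (mem_ball_zero_iff.1 hx)]
    ring
  have h := tc_congr hev (n + 1)
  have ha : AnalyticAt ℂ (fun x => wF x * deriv (fun a => phi a ^ (m + 1)) x) 0 :=
    analyticAt_wF.mul hψ.deriv
  have hb : AnalyticAt ℂ (fun x => wF x - 1) 0 := analyticAt_wF.sub analyticAt_const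
  rw [tc_X_mul ha, tc_mul analyticAt_wF hψ.deriv, tc_const_mul,
    tc_mul hb hψ] at h
  simp only [tc_deriv] at h
  rw [h]
  congr 1
  rw [Finset.sum_range_succ' _ (n + 1), Finset.sum_range_succ' _ (n + 1)]
  have hc : ∀ i, tc (fun x => wF x - 1) (i + 1) = tc wF (i + 1) := by
    intro i
    rw [tc, tc, iteratedDeriv_succ', iteratedDeriv_succ']
    congr 2
    funext x
    exact deriv_sub_const 1
  have hc0 : tc (fun x => wF x - 1) 0 = 0 := by
    rw [tc_zero, wF, F_zero]; norm_num
  have hc1 : tc wF 0 = 1 := tc_wF_values.1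
  simp only [hc, hc0, hc1]
  simp

lemma xiCoeff_eq (n : ℕ) : xiCoeff n = tc (fun a => phi a ^ (n + 1)) n / (n + 1) := by
  have h3 : (n.factorial : ℂ) ≠ 0 := by exact_mod_cast n.factorial_ne_zero
  have hn1 : (n : ℂ) + 1 ≠ 0 := by exact_mod_cast n.succ_ne_zero
  rw [xiCoeff, tc, Nat.factorial_succ]
  push_cast
  field_simp

lemma tc_phi_pow_rec_values (m : ℕ) (ψ : ℕ → ℂ) (hψ : ψ = tc (fun a => phi a ^ (m + 1))) :
    ψ 0 = 1 ∧
    ψ 1 = -(m + 1) / 2 ∧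
    2 * ψ 2 = ψ 1 / 2 + (m + 1) * (-ψ 1 / 2 - 5 / 32) ∧
    3 * ψ 3 = ψ 2 + 5 / 32 * ψ 1 + (m + 1) * (-ψ 2 / 2 - 5 / 32 * ψ 1 - 5 / 64) ∧
    4 * ψ 4 = 3 / 2 * ψ 3 + 5 / 16 * ψ 2 + 5 / 64 * ψ 1
      + (m + 1) * (-ψ 3 / 2 - 5 / 32 * ψ 2 - 5 / 64 * ψ 1 - 389 / 8192) ∧
    5 * ψ 5 = 2 * ψ 4 + 15 / 32 * ψ 3 + 5 / 32 * ψ 2 + 389 / 8192 * ψ 1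
      + (m + 1) * (-ψ 4 / 2 - 5 / 32 * ψ 3 - 5 / 64 * ψ 2 - 389 / 8192 * ψ 1 - 527 / 16384) ∧
    6 * ψ 6 = 5 / 2 * ψ 5 + 5 / 8 * ψ 4 + 15 / 64 * ψ 3 + 389 / 4096 * ψ 2 + 527 / 16384 * ψ 1
      + (m + 1) * (-ψ 5 / 2 - 5 / 32 * ψ 4 - 5 / 64 * ψ 3 - 389 / 8192 * ψ 2 - 527 / 16384 * ψ 1
        - 6121 / 262144) := by
  obtain ⟨b0, b1, b2, b3, b4, b5, b6⟩ := tc_wF_values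
  have h0 : ψ 0 = 1 := by rw [hψ, tc_zero, phi_zero, one_pow]
  have hrec := tc_phi_pow_rec m
  rw [← hψ] at hrec
  have r0 := hrec 0
  have r1 := hrec 1
  have r2 := hrec 2
  have r3 := hrec 3
  have r4 := hrec 4
  have r5 := hrec 5
  simp only [Finset.sum_range_succ, Finset.sum_range_zero, b0, b1, b2, b3, b4, b5, b6, h0,
    Nat.sub_self, Nat.reduceSub, Nat.reduceAdd, Nat.sub_zero, zero_add, Nat.cast_zero,
    Nat.cast_one, Nat.cast_ofNat] at r0 r1 r2 r3 r4 r5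
  refine ⟨h0, ?_, ?_, ?_, ?_, ?_, ?_⟩
  · linear_combination r0
  · linear_combination r1
  · linear_combination r2
  · linear_combination r3
  · linear_combination r4
  · linear_combination r5

/-- For index `n ≥ 1` the recursion for `φ^(n+1)` determines `n` times its `n`-th coefficient, and
`xiCoeff_eq` divides by `n + 1`. Hence the divisors `n(n + 1)`: 2, 6, 12, 20, 30, 42. -/
lemma xiCoeff_values : xiCoeff 0 = 1 ∧ xiCoeff 1 = -1 / 2 ∧
      xiCoeff 2 = 11 / 64 ∧ xiCoeff 3 = -3 / 64 ∧
      xiCoeff 4 = 359 / 32768 ∧ xiCoeff 5 = -75 / 32768 ∧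
      xiCoeff 6 = 919 / 2097152 := by
  simp only [xiCoeff_eq]
  refine ⟨?_, ?_, ?_, ?_, ?_, ?_, ?_⟩
  · rw [tc_zero, phi_zero]; norm_num
  · obtain ⟨h0, h1, h2, h3, h4, h5, h6⟩ := tc_phi_pow_rec_values 1 _ rfl
    push_cast at *
    linear_combination h1 / 2
  · obtain ⟨h0, h1, h2, h3, h4, h5, h6⟩ := tc_phi_pow_rec_values 2 _ rfl
    push_cast at *
    rw [h1] at h2
    linear_combination h2 / 6
  · obtain ⟨h0, h1, h2, h3, h4, h5, h6⟩ := tc_phi_pow_rec_values 3 _ rfl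
    push_cast at *
    have e2 : tc (fun a => phi a ^ (3 + 1)) 2 = 19 / 16 := by rw [h1] at h2; linear_combination h2 / 2
    rw [h1, e2] at h3
    linear_combination h3 / 12
  · obtain ⟨h0, h1, h2, h3, h4, h5, h6⟩ := tc_phi_pow_rec_values 4 _ rfl
    push_cast at *
    have e2 : tc (fun a => phi a ^ (4 + 1)) 2 = 135 / 64 := by
      rw [h1] at h2; linear_combination h2 / 2
    have e3 : tc (fun a => phi a ^ (4 + 1)) 3 = -85 / 128 := by
      rw [h1, e2] at h3; linear_combination h3 / 3
    rw [h1, e2, e3] at h4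
    linear_combination h4 / 20
  · obtain ⟨h0, h1, h2, h3, h4, h5, h6⟩ := tc_phi_pow_rec_values 5 _ rfl
    push_cast at *
    have e2 : tc (fun a => phi a ^ (5 + 1)) 2 = 105 / 32 := by
      rw [h1] at h2; linear_combination h2 / 2
    have e3 : tc (fun a => phi a ^ (5 + 1)) 3 = -25 / 16 := by
      rw [h1, e2] at h3; linear_combination h3 / 3
    have e4 : tc (fun a => phi a ^ (5 + 1)) 4 = 4833 / 16384 := by
      rw [h1, e2, e3] at h4; linear_combination h4 / 4
    rw [h1, e2, e3, e4] at h5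
    linear_combination h5 / 30
  · obtain ⟨h0, h1, h2, h3, h4, h5, h6⟩ := tc_phi_pow_rec_values 6 _ rfl
    push_cast at *
    have e2 : tc (fun a => phi a ^ (6 + 1)) 2 = 301 / 64 := by
      rw [h1] at h2; linear_combination h2 / 2
    have e3 : tc (fun a => phi a ^ (6 + 1)) 3 = -385 / 128 := by
      rw [h1, e2] at h3; linear_combination h3 / 3
    have e4 : tc (fun a => phi a ^ (6 + 1)) 4 = 29897 / 32768 := by
      rw [h1, e2, e3] at h4; linear_combination h4 / 4
    have e5 : tc (fun a => phi a ^ (6 + 1)) 5 = -7259 / 65536 := by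
      rw [h1, e2, e3, e4] at h5; linear_combination h5 / 5
    rw [h1, e2, e3, e4, e5] at h6
    linear_combination h6 / 42

end PicardPoles
end

/-! ### The Weierstrass function with moving periods. -/

noncomputable section
namespace PicardPoles
open Filter Topology Set Metric

/-- The point `p.1 W₁ + p.2 W₂` of the lattice spanned by the periods `W₁ = 2 w₁`, `W₂ = 2 w₂`. -/
def latPt (w₁ w₂ : ℂ) (p : ℤ × ℤ) : ℂ := p.1 * (2 * w₁) + p.2 * (2 * w₂)

/-- Indexing by `ℤ × ℤ` instead of by the lattice fixes the index set while the periods vary. The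
origin needs no separate treatment since `1 / 0 ^ 2 = 0`. -/
lemma wp_eq_tsum {w₁ w₂ : ℂ} (h : LinearIndependent ℝ ![2 * w₁, 2 * w₂]) (z : ℂ) :
    wp w₁ w₂ z = ∑' p : ℤ × ℤ, (1 / (z - latPt w₁ w₂ p) ^ 2 - 1 / latPt w₁ w₂ p ^ 2) := by
  rw [wp, dif_pos h, PeriodPair.weierstrassP,
    ← (PeriodPair.mk _ _ h).latticeEquivProd.symm.toEquiv.tsum_eq]
  refine tsum_congr fun p => ?_
  have := (PeriodPair.mk _ _ h).latticeEquiv_symm_apply p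
  simp only [LinearEquiv.coe_toEquiv, this, latPt]

/-- An injective linear map on a finite-dimensional space is bounded below. Real coefficients are
allowed so that linear independence can later be transported to nearby periods. -/
lemma exists_norm_le_latPt {w₁ w₂ : ℂ} (h : LinearIndependent ℝ ![2 * w₁, 2 * w₂]) :
    ∃ c : ℝ, 0 < c ∧ ∀ a b : ℝ, c * max |a| |b| ≤ ‖(a : ℂ) * (2 * w₁) + b * (2 * w₂)‖ := by
  let f : ℝ × ℝ →ₗ[ℝ] ℂ := (LinearMap.fst ℝ ℝ ℝ).smulRight (2 * w₁) +
    (LinearMap.snd ℝ ℝ ℝ).smulRight (2 * w₂)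
  have hf : ∀ a b : ℝ, f (a, b) = (a : ℂ) * (2 * w₁) + b * (2 * w₂) := by
    intro a b
    simp [f]
  have hker : LinearMap.ker f = ⊥ := by
    rw [LinearMap.ker_eq_bot']
    rintro ⟨a, b⟩ hab
    rw [hf] at hab
    have := LinearIndependent.pair_iff.1 h a b (by simpa using hab)
    simp [this.1, this.2]
  obtain ⟨K, hK, hA⟩ := f.exists_antilipschitzWith hker
  have hK' : (0 : ℝ) < K := by exact_mod_cast hK
  refine ⟨(K : ℝ)⁻¹, inv_pos.2 hK', fun a b => ?_⟩
  have := hA.le_mul_dist (a, b) 0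
  rw [map_zero, dist_zero_right, dist_zero_right, hf, Prod.norm_def] at this
  rw [inv_mul_le_iff₀ hK']
  simpa using this

lemma finite_latPt_lt {w₁ w₂ : ℂ} (h : LinearIndependent ℝ ![2 * w₁, 2 * w₂]) (R : ℝ) :
    {p : ℤ × ℤ | ‖latPt w₁ w₂ p‖ < R}.Finite := by
  obtain ⟨c, hc, hb⟩ := exists_norm_le_latPt h
  have hfin : (Set.Icc (-⌈R / c⌉) ⌈R / c⌉ ×ˢ Set.Icc (-⌈R / c⌉) ⌈R / c⌉).Finite :=
    (Set.finite_Icc _ _).prod (Set.finite_Icc _ _)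
  refine hfin.subset ?_
  rintro ⟨m, n⟩ hp
  have h1 := (hb m n).trans_lt (by simpa [latPt] using hp)
  rw [← lt_div_iff₀' hc, max_lt_iff] at h1
  have h2 : |m| ≤ ⌈R / c⌉ := by
    exact_mod_cast (Int.cast_abs (R := ℝ) (a := m) ▸ h1.1.le.trans (Int.le_ceil _))
  have h3 : |n| ≤ ⌈R / c⌉ := by
    exact_mod_cast (Int.cast_abs (R := ℝ) (a := n) ▸ h1.2.le.trans (Int.le_ceil _))
  exact ⟨⟨(abs_le.1 h2).1, (abs_le.1 h2).2⟩, ⟨(abs_le.1 h3).1, (abs_le.1 h3).2⟩⟩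

lemma summable_latPt {w₁ w₂ : ℂ} (h : LinearIndependent ℝ ![2 * w₁, 2 * w₂]) :
    Summable fun p : ℤ × ℤ => ‖latPt w₁ w₂ p‖ ^ (-3 : ℝ) := by
  have h1 : Summable fun l : (PeriodPair.mk _ _ h).lattice => ‖l‖ ^ (-3 : ℝ) :=
    ZLattice.summable_norm_rpow _ _ (by simp; norm_num)
  rw [← (PeriodPair.mk _ _ h).latticeEquivProd.symm.toEquiv.summable_iff] at h1
  refine h1.congr fun p => ?_
  have := (PeriodPair.mk _ _ h).latticeEquiv_symm_apply p
  simp only [Function.comp_apply, LinearEquiv.coe_toEquiv, latPt, ← this, Submodule.coe_norm]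

/-- Lattice points move comparably: near `t₀` they are at least half as large as at `t₀`. -/
lemma eventually_half_le_norm {w₁ w₂ : ℂ → ℂ} {t₀ : ℂ} (h₁ : ContinuousAt w₁ t₀)
    (h₂ : ContinuousAt w₂ t₀) (h : LinearIndependent ℝ ![2 * w₁ t₀, 2 * w₂ t₀]) :
    ∀ᶠ t in 𝓝 t₀, ∀ a b : ℝ, ‖(a : ℂ) * (2 * w₁ t₀) + b * (2 * w₂ t₀)‖ / 2 ≤
      ‖(a : ℂ) * (2 * w₁ t) + b * (2 * w₂ t)‖ := by
  obtain ⟨c, hc, hb⟩ := exists_norm_le_latPt h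
  -- Two shifts with factors `2|a|` and `2|b|` add up to at most `(c/2) max |a| |b|`, half of the
  -- lower bound.
  have e1 := Metric.continuousAt_iff'.1 h₁ (c / 8) (by positivity)
  have e2 := Metric.continuousAt_iff'.1 h₂ (c / 8) (by positivity)
  filter_upwards [e1, e2] with t k1 k2 a b
  rw [dist_eq_norm] at k1 k2
  have hd : (a : ℂ) * (2 * w₁ t) + b * (2 * w₂ t) = ((a : ℂ) * (2 * w₁ t₀) + b * (2 * w₂ t₀))
      - (-(2 * (a : ℂ) * (w₁ t - w₁ t₀) + 2 * b * (w₂ t - w₂ t₀))) := by ring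
  have hn : ‖-(2 * (a : ℂ) * (w₁ t - w₁ t₀) + 2 * b * (w₂ t - w₂ t₀))‖ ≤ c / 2 * max |a| |b| := by
    rw [norm_neg]
    refine (norm_add_le _ _).trans ?_
    simp only [norm_mul, Complex.norm_real, Real.norm_eq_abs, Complex.norm_ofNat]
    have m1 := le_max_left |a| |b|
    have m2 := le_max_right |a| |b|
    have := mul_le_mul m1 k1.le (norm_nonneg _) (le_trans (abs_nonneg _) m1)
    have := mul_le_mul m2 k2.le (norm_nonneg _) (le_trans (abs_nonneg _) m1)
    linarith
  have hs := norm_sub_norm_le ((a : ℂ) * (2 * w₁ t₀) + b * (2 * w₂ t₀))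
    (-(2 * (a : ℂ) * (w₁ t - w₁ t₀) + 2 * b * (w₂ t - w₂ t₀)))
  rw [hd]
  have := hb a b
  linarith

lemma linearIndependent_of_half_le {w₁ w₂ v₁ v₂ : ℂ}
    (h : LinearIndependent ℝ ![2 * w₁, 2 * w₂])
    (hle : ∀ a b : ℝ, ‖(a : ℂ) * (2 * w₁) + b * (2 * w₂)‖ / 2 ≤
      ‖(a : ℂ) * (2 * v₁) + b * (2 * v₂)‖) : LinearIndependent ℝ ![2 * v₁, 2 * v₂] := by
  rw [LinearIndependent.pair_iff] at h ⊢
  intro a b hab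
  refine h a b ?_
  have := hle a b
  have e : (a : ℂ) * (2 * v₁) + b * (2 * v₂) = 0 := by simpa using hab
  rw [e, norm_zero] at this
  have h0 : ‖(a : ℂ) * (2 * w₁) + b * (2 * w₂)‖ = 0 := le_antisymm (by linarith) (norm_nonneg _)
  simpa using norm_eq_zero.1 h0

/-- Near `t₀` the Weierstrass function with analytically moving periods and argument is the sum
of an analytic function and finitely many principal parts. -/
lemma wp_eventually_eq {w₁ w₂ z : ℂ → ℂ} {t₀ : ℂ} (h₁ : AnalyticAt ℂ w₁ t₀)
    (h₂ : AnalyticAt ℂ w₂ t₀) (hz : AnalyticAt ℂ z t₀)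
    (h : LinearIndependent ℝ ![2 * w₁ t₀, 2 * w₂ t₀]) :
    ∃ (S : Finset (ℤ × ℤ)) (f : ℂ → ℂ), AnalyticAt ℂ f t₀ ∧
      (∀ p, z t₀ = latPt (w₁ t₀) (w₂ t₀) p → p ∈ S) ∧
      ∀ᶠ t in 𝓝 t₀, wp (w₁ t) (w₂ t) (z t) =
        f t + ∑ p ∈ S, 1 / (z t - latPt (w₁ t) (w₂ t) p) ^ 2 := by
  classical
  set r : ℝ := ‖z t₀‖ + 1 with hr
  have hr0 : 0 < r := by positivity
  have hlat : ∀ p, AnalyticAt ℂ (fun t => latPt (w₁ t) (w₂ t) p) t₀ := fun p =>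
    (analyticAt_const.mul (analyticAt_const.mul h₁)).add
      (analyticAt_const.mul (analyticAt_const.mul h₂))
  -- Outside `S` a lattice point has norm at least `4r` at `t₀`, hence at least `2r` nearby. This is
  -- the range of `weierstrassP_bound`, and it keeps the point away from `0` and from `z t`.
  set S := (finite_latPt_lt h (4 * r)).toFinset with hS
  have hmem : ∀ p, p ∈ S ↔ ‖latPt (w₁ t₀) (w₂ t₀) p‖ < 4 * r := fun p => by simp [hS]
  let T : ℤ × ℤ → ℂ → ℂ := fun p t => 1 / (z t - latPt (w₁ t) (w₂ t) p) ^ 2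
    - 1 / latPt (w₁ t) (w₂ t) p ^ 2
  let g : ℤ × ℤ → ℂ → ℂ := fun p t => if p ∈ S then 0 else T p t
  -- `80 = 10 · 8`: the factor `10` is from `weierstrassP_bound`, and `8` from halving the norm
  -- inside a power `-3`.
  let u : ℤ × ℤ → ℝ := fun p => 80 * r * ‖latPt (w₁ t₀) (w₂ t₀) p‖ ^ (-3 : ℝ)
  have hu : Summable u := (summable_latPt h).mul_left _
  have ev : ∀ᶠ t in 𝓝 t₀, AnalyticAt ℂ w₁ t ∧ AnalyticAt ℂ w₂ t ∧ AnalyticAt ℂ z t ∧ ‖z t‖ < r ∧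
      ∀ a b : ℝ, ‖(a : ℂ) * (2 * w₁ t₀) + b * (2 * w₂ t₀)‖ / 2 ≤
      ‖(a : ℂ) * (2 * w₁ t) + b * (2 * w₂ t)‖ := by
    have hzr : ∀ᶠ t in 𝓝 t₀, ‖z t‖ < r :=
      hz.continuousAt.norm.eventually (gt_mem_nhds (by rw [hr]; linarith))
    exact h₁.eventually_analyticAt.and (h₂.eventually_analyticAt.and
      (hz.eventually_analyticAt.and (hzr.and
        (eventually_half_le_norm h₁.continuousAt h₂.continuousAt h))))
  obtain ⟨U, hUsub, hU, ht₀⟩ := _root_.mem_nhds_iff.1 ev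
  have hhalf : ∀ t ∈ U, ∀ p, ‖latPt (w₁ t₀) (w₂ t₀) p‖ / 2 ≤ ‖latPt (w₁ t) (w₂ t) p‖ := by
    intro t ht p
    simpa [latPt] using (hUsub ht).2.2.2.2 p.1 p.2
  have hg : ∀ p, ∀ t ∈ U, ‖g p t‖ ≤ u p := by
    intro p t ht
    simp only [g, u]
    split_ifs with hp
    · rw [norm_zero]; positivity
    · rw [hmem, not_lt] at hp
      have h2 := hhalf t ht p
      have hb := PeriodPair.weierstrassP_bound r hr0 _ (hUsub ht).2.2.2.1 (latPt (w₁ t) (w₂ t) p)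
        (by linarith)
      refine hb.trans ?_
      have hpos : 0 < ‖latPt (w₁ t₀) (w₂ t₀) p‖ / 2 := by linarith
      have h3 := Real.rpow_le_rpow_of_nonpos hpos h2 (by norm_num : (-3 : ℝ) ≤ 0)
      rw [Real.div_rpow (norm_nonneg _) (by norm_num)] at h3
      have h8 : (2 : ℝ) ^ (-3 : ℝ) = 1 / 8 := by
        rw [Real.rpow_neg (by norm_num)]; norm_num
      rw [h8] at h3
      calc 10 * r * ‖latPt (w₁ t) (w₂ t) p‖ ^ (-3 : ℝ)
          ≤ 10 * r * (‖latPt (w₁ t₀) (w₂ t₀) p‖ ^ (-3 : ℝ) / (1 / 8)) := by gcongr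
        _ = _ := by ring
  have hgd : ∀ p, DifferentiableOn ℂ (g p) U := by
    intro p t ht
    simp only [g]
    split_ifs with hp
    · exact differentiableWithinAt_const _
    · rw [hmem, not_lt] at hp
      obtain ⟨d1, d2, d3, d4, -⟩ := hUsub ht
      have h2 := hhalf t ht p
      have dl : DifferentiableAt ℂ (fun t => latPt (w₁ t) (w₂ t) p) t :=
        ((d1.differentiableAt.const_mul _).const_mul _).add
          ((d2.differentiableAt.const_mul _).const_mul _)
      have n1 : latPt (w₁ t) (w₂ t) p ≠ 0 := by
        intro h0
        rw [h0, norm_zero] at h2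
        linarith
      have n2 : z t - latPt (w₁ t) (w₂ t) p ≠ 0 := by
        intro h0
        rw [← sub_eq_zero.1 h0] at h2
        linarith
      exact (((differentiableAt_const _).div ((d3.differentiableAt.sub dl).pow 2)
        (pow_ne_zero 2 n2)).sub ((differentiableAt_const _).div (dl.pow 2)
        (pow_ne_zero 2 n1))).differentiableWithinAt
  have hG := Complex.differentiableOn_tsum_of_summable_norm hu hgd hU hg
  refine ⟨S, fun t => (∑' p, g p t) - ∑ p ∈ S, 1 / latPt (w₁ t) (w₂ t) p ^ 2, ?_, ?_, ?_⟩
  · refine (hG.analyticAt (hU.mem_nhds ht₀)).sub (Finset.analyticAt_fun_sum _ fun p _ => ?_)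
    -- The zero index gives `1 / 0 ^ 2` for every `t`, a constant. The other lattice points in `S`
    -- do not vanish at `t₀`.
    by_cases hp : p = 0
    · simp only [hp, latPt, Prod.fst_zero, Prod.snd_zero, Int.cast_zero, zero_mul, add_zero]
      exact analyticAt_const
    · refine analyticAt_const.div ((hlat p).pow 2) (pow_ne_zero 2 fun h0 => hp ?_)
      have := LinearIndependent.pair_iff.1 h p.1 p.2 (by simpa [latPt] using h0)
      exact Prod.ext (by exact_mod_cast this.1) (by exact_mod_cast this.2)
  · intro p hp
    rw [hmem, ← hp]
    linarith
  · filter_upwards [hU.mem_nhds ht₀] with t ht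
    rw [wp_eq_tsum (linearIndependent_of_half_le h (hUsub ht).2.2.2.2)]
    have e : ∀ p, 1 / (z t - latPt (w₁ t) (w₂ t) p) ^ 2 - 1 / latPt (w₁ t) (w₂ t) p ^ 2
        = g p t + if p ∈ S then T p t else 0 := by
      intro p
      simp only [g]
      split_ifs <;> simp [T]
    have s1 : Summable fun p => g p t := hu.of_norm_bounded fun p => hg p t ht
    have s2 : HasSum (fun p => if p ∈ S then T p t else 0) (∑ p ∈ S, T p t) := by
      have : HasSum (fun p => if p ∈ S then T p t else 0) (∑ p ∈ S, if p ∈ S then T p t else 0) :=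
        hasSum_sum_of_ne_finset_zero fun p hp => if_neg hp
      rwa [Finset.sum_congr rfl fun p hp => if_pos hp] at this
    simp only [e]
    rw [s1.tsum_add s2.summable, s2.tsum_eq]
    simp only [T, Finset.sum_sub_distrib]
    ring

lemma analyticAt_wp {w₁ w₂ z : ℂ → ℂ} {t₀ : ℂ} (h₁ : AnalyticAt ℂ w₁ t₀)
    (h₂ : AnalyticAt ℂ w₂ t₀) (hz : AnalyticAt ℂ z t₀)
    (h : LinearIndependent ℝ ![2 * w₁ t₀, 2 * w₂ t₀])
    (hn : ∀ p, z t₀ ≠ latPt (w₁ t₀) (w₂ t₀) p) :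
    AnalyticAt ℂ (fun t => wp (w₁ t) (w₂ t) (z t)) t₀ := by
  obtain ⟨S, f, hf, -, he⟩ := wp_eventually_eq h₁ h₂ hz h
  refine AnalyticAt.congr (hf.add (Finset.analyticAt_fun_sum S fun p _ => ?_))
    (he.mono fun t ht => ht.symm)
  have hlat : AnalyticAt ℂ (fun t => latPt (w₁ t) (w₂ t) p) t₀ :=
    (analyticAt_const.mul (analyticAt_const.mul h₁)).add
      (analyticAt_const.mul (analyticAt_const.mul h₂))
  exact analyticAt_const.div ((hz.sub hlat).pow 2) (pow_ne_zero 2 (sub_ne_zero.2 (hn p)))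

lemma latPt_injective {w₁ w₂ : ℂ} (h : LinearIndependent ℝ ![2 * w₁, 2 * w₂]) :
    Function.Injective (latPt w₁ w₂) := by
  intro p q hpq
  have := LinearIndependent.pair_iff.1 h (p.1 - q.1) (p.2 - q.2) (by
    simp only [latPt] at hpq
    simp
    linear_combination hpq)
  exact Prod.ext (by exact_mod_cast sub_eq_zero.1 this.1)
    (by exact_mod_cast sub_eq_zero.1 this.2)

lemma wp_eventually_eq_of_eq_latPt {w₁ w₂ z : ℂ → ℂ} {t₀ : ℂ} (h₁ : AnalyticAt ℂ w₁ t₀)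
    (h₂ : AnalyticAt ℂ w₂ t₀) (hz : AnalyticAt ℂ z t₀)
    (h : LinearIndependent ℝ ![2 * w₁ t₀, 2 * w₂ t₀]) {p₀ : ℤ × ℤ}
    (hp₀ : z t₀ = latPt (w₁ t₀) (w₂ t₀) p₀) :
    ∃ f : ℂ → ℂ, AnalyticAt ℂ f t₀ ∧ ∀ᶠ t in 𝓝 t₀, wp (w₁ t) (w₂ t) (z t) =
        f t + ((z t - latPt (w₁ t) (w₂ t) p₀) ^ 2)⁻¹ := by
  obtain ⟨S, f, hf, hS, he⟩ := wp_eventually_eq h₁ h₂ hz h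
  refine ⟨fun t => f t + ∑ p ∈ S.erase p₀, 1 / (z t - latPt (w₁ t) (w₂ t) p) ^ 2,
    hf.add (Finset.analyticAt_fun_sum _ fun p hp => ?_), he.mono fun t ht => ?_⟩
  · have hlat : AnalyticAt ℂ (fun t => latPt (w₁ t) (w₂ t) p) t₀ :=
      (analyticAt_const.mul (analyticAt_const.mul h₁)).add
        (analyticAt_const.mul (analyticAt_const.mul h₂))
    refine analyticAt_const.div ((hz.sub hlat).pow 2) (pow_ne_zero 2 (sub_ne_zero.2 fun h0 => ?_))
    exact (Finset.ne_of_mem_erase hp) (latPt_injective h (h0.symm.trans hp₀))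
  · rw [ht, ← Finset.add_sum_erase S _ (hS p₀ hp₀), one_div]
    ring

/-- An analytic function plus the inverse square of a non-trivially vanishing one has a pole. -/
lemma isPole_of_eventually_eq {y f g : ℂ → ℂ} {t₀ : ℂ} (hf : AnalyticAt ℂ f t₀)
    (hg : AnalyticAt ℂ g t₀) (hg0 : g t₀ = 0) (hne : ∀ᶠ t in 𝓝[≠] t₀, g t ≠ 0)
    (hy : ∀ᶠ t in 𝓝 t₀, y t = f t + (g t ^ 2)⁻¹) : IsPole y t₀ := by
  have hy' : y =ᶠ[𝓝[≠] t₀] f + (g ^ 2)⁻¹ := hy.filter_mono nhdsWithin_le_nhds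
  have hm2 : MeromorphicAt ((g ^ 2)⁻¹) t₀ := (hg.meromorphicAt.pow 2).inv
  have hord : 0 < meromorphicOrderAt g t₀ := by
    rw [← tendsto_zero_iff_meromorphicOrderAt_pos hg.meromorphicAt, ← hg0]
    exact hg.continuousAt.tendsto.mono_left nhdsWithin_le_nhds
  have hfin : meromorphicOrderAt g t₀ ≠ ⊤ :=
    (meromorphicOrderAt_ne_top_iff_eventually_ne_zero hg.meromorphicAt).2 hne
  have hneg : meromorphicOrderAt ((g ^ 2)⁻¹) t₀ < 0 := by
    rw [meromorphicOrderAt_inv, meromorphicOrderAt_pow hg.meromorphicAt]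
    lift meromorphicOrderAt g t₀ to ℤ using hfin with n
    have hn : 0 < n := by exact_mod_cast hord
    have : -((2 : ℤ) * n) < 0 := by linarith
    have h2 : ((-((2 : ℤ) * n) : ℤ) : WithTop ℤ) < 0 := by exact_mod_cast this
    exact h2
  have hadd : MeromorphicAt (f + (g ^ 2)⁻¹) t₀ := hf.meromorphicAt.add hm2
  refine ⟨hadd.congr hy'.symm, ?_⟩
  rw [meromorphicOrderAt_congr hy', meromorphicOrderAt_add_eq_right_of_lt hf.meromorphicAt
    (hneg.trans_le hf.meromorphicOrderAt_nonneg)]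
  exact hneg

end PicardPoles
end

/-! ### Poles of the Picard function near `x = 0`. -/

noncomputable section
namespace PicardPoles
open Filter Topology Set Metric

lemma xi_spec {ξ₀ : ℝ} (h0 : 0 < ξ₀) (h1 : ξ₀ < 1) {x : ℂ}
    (hx : ∀ a : ℂ, ‖a‖ = ξ₀ → ‖x * phi a‖ < ξ₀) :
    Summable (fun n : ℕ => xiCoeff n * x ^ (n + 1)) ∧ ‖xi x‖ < ξ₀ ∧ xi x = x * phi (xi x) ∧
      ∀ η : ℂ, ‖η‖ < ξ₀ → η = x * phi η → η = xi x := by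
  obtain ⟨p, hp, he, hu, hs⟩ := lagrange_inversion h0 h1 differentiableOn_phi hx
  have hs' : HasSum (fun n : ℕ => xiCoeff n * x ^ (n + 1)) p := hs
  have hxi : xi x = p := hs'.tsum_eq
  rw [hxi]
  exact ⟨hs'.summable, hp, he, hu⟩

/-- `E = F₁/F + ln 16`, so that `φ = exp(-E)`. -/
def expo (a : ℂ) : ℂ := F₁ a / F a + (Real.log 16 : ℂ)

lemma exp_log_sixteen : Complex.exp (Real.log 16 : ℂ) = 16 := by
  rw [← Complex.ofReal_exp, Real.exp_log (by norm_num)]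
  norm_num

lemma phi_eq_exp (a : ℂ) : phi a = Complex.exp (-expo a) := by
  rw [phi, expo, neg_add, Complex.exp_add, Complex.exp_neg (Real.log 16 : ℂ), exp_log_sixteen]
  ring

lemma expo_zero : expo 0 = 0 := by
  rw [expo, F_zero, F₁_zero]
  ring

/-- One disk serves all later purposes: `|E| < 1` bounds `|φ|` and `|e^E|` by `3`, keeps the periods
independent, and keeps the principal logarithm of `ξ/x = e^(-E)` on the right branch. -/
lemma exists_expo_lt_one : ∃ ξ₀ : ℝ, 0 < ξ₀ ∧ ξ₀ < 1 ∧ ∀ a : ℂ, ‖a‖ ≤ ξ₀ → ‖expo a‖ < 1 := by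
  have hd : ContinuousAt expo 0 := by
    have h := ((hasDerivAt_F₁ (x := 0) (by simp)).div (hasDerivAt_F (x := 0) (by simp))
      (F_ne_zero (by simp))).continuousAt
    exact h.add continuousAt_const
  have he : ∀ᶠ a in 𝓝 (0 : ℂ), ‖expo a‖ < 1 :=
    hd.norm.eventually (gt_mem_nhds (by simp [expo_zero]))
  obtain ⟨δ, hδ, hsub⟩ := Metric.eventually_nhds_iff.1 he
  refine ⟨min (δ / 2) (1 / 2), by positivity, (min_le_right _ _).trans_lt (by norm_num),
    fun a ha => hsub ?_⟩
  rw [dist_zero_right]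
  exact ha.trans_lt ((min_le_left _ _).trans_lt (by linarith))

lemma norm_exp_lt_three {z : ℂ} (hz : ‖z‖ < 1) : ‖Complex.exp z‖ < 3 := by
  rw [Complex.norm_exp]
  have h1 : z.re < 1 := (Complex.re_le_norm z).trans_lt hz
  exact (Real.exp_lt_exp.2 h1).trans (Real.exp_one_lt_d9.trans (by norm_num))

/-- `L(t) = t + F₁/F(eᵗ) = iπτ`, where `τ = ω₂/ω₁`. -/
def logNome (t : ℂ) : ℂ := t + F₁ (Complex.exp t) / F (Complex.exp t)

lemma add_expo_exp (t : ℂ) :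
    t + expo (Complex.exp t) = (Real.log 16 : ℂ) + logNome t := by
  rw [expo, logNome]
  ring

lemma omega2Cov_eq {t : ℂ} (ht : t.re < 0) :
    omega2Cov t = -(Complex.I / 2) * F (Complex.exp t) * logNome t := by
  have := F_ne_zero (norm_exp_lt_one ht)
  rw [omega2Cov, logNome]
  field_simp

/-- The lattice index is `(k, -N)` so that the coefficient becomes `2N + ν₂`. After the nonvanishing
factor `F` is removed, the lattice condition is affine in `logNome`. -/
lemma argument_sub_latPt {t : ℂ} (ht : t.re < 0) (ν₁ ν₂ : ℂ) (k N : ℤ) :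
    ν₁ * omega1Cov t + ν₂ * omega2Cov t - latPt (omega1Cov t) (omega2Cov t) (k, -N) =
      -(Complex.I / 2) * F (Complex.exp t) *
        ((2 * N + ν₂) * logNome t - Complex.I * Real.pi * (2 * k - ν₁)) := by
  rw [omega2Cov_eq ht, omega1Cov, latPt]
  push_cast
  linear_combination (-(Real.pi : ℂ) / 2 * (2 * k - ν₁) * F (Complex.exp t)) * Complex.I_sq

lemma argument_eq_latPt_iff {t : ℂ} (ht : t.re < 0) (ν₁ ν₂ : ℂ) (k N : ℤ) :
    ν₁ * omega1Cov t + ν₂ * omega2Cov t = latPt (omega1Cov t) (omega2Cov t) (k, -N) ↔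
      (2 * N + ν₂) * logNome t = Complex.I * Real.pi * (2 * k - ν₁) := by
  rw [← sub_eq_zero, argument_sub_latPt ht, mul_eq_zero, or_iff_right, sub_eq_zero]
  exact mul_ne_zero (by simp) (F_ne_zero (norm_exp_lt_one ht))

lemma linearIndependent_periods {t : ℂ} (ht : t.re < 0) (he : ‖expo (Complex.exp t)‖ < 1) :
    LinearIndependent ℝ ![2 * omega1Cov t, 2 * omega2Cov t] := by
  have hF := F_ne_zero (norm_exp_lt_one ht)
  -- This is `Im τ > 0`. It holds since `L = t + E - ln 16` with `Re t < 0` and `Re E < 1 < ln 16`.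
  have hL : (logNome t).re < 0 := by
    have h1 : (t + expo (Complex.exp t)).re = ((Real.log 16 : ℂ) + logNome t).re := by
      rw [add_expo_exp]
    rw [Complex.add_re, Complex.add_re, Complex.ofReal_re] at h1
    have h2 := (Complex.re_le_norm (expo (Complex.exp t))).trans_lt he
    have h3 : (1 : ℝ) < Real.log 16 := by
      rw [Real.lt_log_iff_exp_lt (by norm_num)]
      exact Real.exp_one_lt_d9.trans (by norm_num)
    linarith
  rw [LinearIndependent.pair_iff]
  intro a b hab
  rw [omega2Cov_eq ht, omega1Cov] at hab
  have h1 : F (Complex.exp t) * ((a : ℂ) * Real.pi - Complex.I * (b * logNome t)) = 0 := by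
    simp only [Complex.real_smul] at hab
    linear_combination hab
  have h2 := (mul_eq_zero.1 h1).resolve_left hF
  have hre := congrArg Complex.re h2
  have him := congrArg Complex.im h2
  simp at hre him
  have hb : b = 0 := him.resolve_right hL.ne
  refine ⟨?_, hb⟩
  rw [hb] at hre
  simpa [Real.pi_ne_zero] using hre

lemma analyticAt_omega1Cov {t : ℂ} (ht : t.re < 0) : AnalyticAt ℂ omega1Cov t :=
  differentiableOn_omega1Cov.analyticAt
    ((isOpen_lt Complex.continuous_re continuous_const).mem_nhds ht)

lemma analyticAt_omega2Cov {t : ℂ} (ht : t.re < 0) : AnalyticAt ℂ omega2Cov t :=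
  differentiableOn_omega2Cov.analyticAt
    ((isOpen_lt Complex.continuous_re continuous_const).mem_nhds ht)

lemma exp_xkNLift (ν₁ ν₂ : ℂ) (k N : ℤ) :
    Complex.exp (xkNLift ν₁ ν₂ k N) = xkN ν₁ ν₂ k N := by
  rw [xkNLift, xkN, Complex.exp_add, exp_log_sixteen]

lemma xkN_ne_zero (ν₁ ν₂ : ℂ) (k N : ℤ) : xkN ν₁ ν₂ k N ≠ 0 := by
  rw [← exp_xkNLift]
  exact Complex.exp_ne_zero _

lemma re_neg_of_norm_exp_lt_one {t : ℂ} (h : ‖Complex.exp t‖ < 1) : t.re < 0 := by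
  rwa [Complex.norm_exp, Real.exp_lt_one_iff] at h

lemma isPole_picardCov {ξ₀ : ℝ} (h1 : ξ₀ < 1) (hE : ∀ a : ℂ, ‖a‖ ≤ ξ₀ → ‖expo a‖ < 1)
    {ν₁ ν₂ x t : ℂ} {k N : ℤ} (hN : 2 * (N : ℂ) + ν₂ ≠ 0)
    (hu : ∀ η : ℂ, ‖η‖ < ξ₀ → η = x * phi η → η = Complex.exp t)
    (hx : Complex.exp (xkNLift ν₁ ν₂ k N) = x) (ht : ‖Complex.exp t‖ < ξ₀)
    (hT : t + expo (Complex.exp t) = xkNLift ν₁ ν₂ k N) : IsPole (picardCov ν₁ ν₂) t := by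
  have hL : ∀ s : ℂ, (2 * N + ν₂) * logNome s = Complex.I * Real.pi * (2 * k - ν₁) ↔
      s + expo (Complex.exp s) = xkNLift ν₁ ν₂ k N := by
    intro s
    rw [add_expo_exp, xkNLift, add_right_inj, mul_div_assoc', eq_div_iff hN, mul_comm]
  have hre := re_neg_of_norm_exp_lt_one (ht.trans h1)
  have ha1 := analyticAt_omega1Cov hre
  have ha2 := analyticAt_omega2Cov hre
  have hz : AnalyticAt ℂ (fun t => ν₁ * omega1Cov t + ν₂ * omega2Cov t) t :=
    (analyticAt_const.mul ha1).add (analyticAt_const.mul ha2)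
  have hp := (argument_eq_latPt_iff hre ν₁ ν₂ k N).2 ((hL t).2 hT)
  obtain ⟨f, hf, hev⟩ := wp_eventually_eq_of_eq_latPt ha1 ha2 hz
    (linearIndependent_periods hre (hE _ ht.le)) hp
  have hlat : AnalyticAt ℂ (fun t => latPt (omega1Cov t) (omega2Cov t) (k, -N)) t :=
    (analyticAt_const.mul (analyticAt_const.mul ha1)).add
      (analyticAt_const.mul (analyticAt_const.mul ha2))
  have hf' : AnalyticAt ℂ (fun t => f t + (1 + Complex.exp t) / 3) t :=
    hf.add ((analyticAt_const.add analyticAt_cexp).div analyticAt_const (by norm_num))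
  refine isPole_of_eventually_eq hf' (hz.sub hlat) (sub_eq_zero.2 hp) ?_ ?_
  · have hnear : ∀ᶠ s in 𝓝[≠] t, ‖Complex.exp s‖ < ξ₀ :=
      (Complex.continuous_exp.continuousAt.norm.eventually (gt_mem_nhds ht)).filter_mono
        nhdsWithin_le_nhds
    -- A second zero `s` near `t`, for the same `(k, N)`, would give a root `eˢ` of the same
    -- Lagrange equation. Uniqueness yields `eˢ = eᵗ`, so `E` agrees at both, and then the lifted
    -- equation forces `s = t`.
    filter_upwards [hnear, self_mem_nhdsWithin] with s hs hst h0
    have hsre := re_neg_of_norm_exp_lt_one (hs.trans h1)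
    have hsT := (hL s).1 ((argument_eq_latPt_iff hsre ν₁ ν₂ k N).1 (sub_eq_zero.1 h0))
    have h2 : Complex.exp s = Complex.exp t := by
      refine hu _ hs ?_
      rw [phi_eq_exp, ← hx, ← hsT, ← Complex.exp_add]
      congr 1
      ring
    refine hst ?_
    rw [h2] at hsT
    exact add_right_cancel (hsT.trans hT.symm)
  · filter_upwards [hev] with s hs
    simp only [picardCov, hs, Pi.sub_apply]
    ring

lemma exists_of_isPole_picardCov {ν₁ ν₂ t : ℂ} (hν : ¬ ∃ m n : ℤ, ν₁ = 2 * m ∧ ν₂ = 2 * n)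
    (ht : t.re < 0) (hE : ‖expo (Complex.exp t)‖ < 1) (hp : IsPole (picardCov ν₁ ν₂) t) :
    ∃ k N : ℤ, 2 * (N : ℂ) + ν₂ ≠ 0 ∧ t + expo (Complex.exp t) = xkNLift ν₁ ν₂ k N := by
  have ha1 := analyticAt_omega1Cov ht
  have ha2 := analyticAt_omega2Cov ht
  have hz : AnalyticAt ℂ (fun t => ν₁ * omega1Cov t + ν₂ * omega2Cov t) t :=
    (analyticAt_const.mul ha1).add (analyticAt_const.mul ha2)
  by_cases hn : ∀ p, ν₁ * omega1Cov t + ν₂ * omega2Cov t ≠ latPt (omega1Cov t) (omega2Cov t) p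
  · have h := analyticAt_wp ha1 ha2 hz (linearIndependent_periods ht hE) hn
    have h' : AnalyticAt ℂ (picardCov ν₁ ν₂) t :=
      h.add ((analyticAt_const.add analyticAt_cexp).div analyticAt_const (by norm_num))
    exact absurd hp.2 (not_lt.2 h'.meromorphicOrderAt_nonneg)
  · push Not at hn
    obtain ⟨⟨k, N⟩, hkN⟩ := hn
    have h := (argument_eq_latPt_iff ht ν₁ ν₂ k (-N)).1 (by rwa [neg_neg])
    -- If the coefficient of `L` vanished, so would `2k - ν₁`, and `ν₁, ν₂` would both be even
    -- integers.
    have hN : 2 * ((-N : ℤ) : ℂ) + ν₂ ≠ 0 := by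
      intro h0
      rw [h0, zero_mul] at h
      refine hν ⟨k, N, ?_, ?_⟩
      · have := (mul_eq_zero.1 h.symm).resolve_left
          (mul_ne_zero Complex.I_ne_zero (by exact_mod_cast Real.pi_ne_zero))
        exact (sub_eq_zero.1 this).symm
      · push_cast at h0
        linear_combination h0
    refine ⟨k, -N, hN, ?_⟩
    rw [add_expo_exp, xkNLift, add_right_inj, mul_div_assoc', eq_div_iff hN, mul_comm, h]

lemma xiLift_eq {T ξ : ℂ} (hξ : xi (Complex.exp T) = ξ) (he : ξ = Complex.exp T * phi ξ)
    (hE : ‖expo ξ‖ < 1) : xiLift T = T - expo ξ := by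
  have h1 : xi (Complex.exp T) / Complex.exp T = Complex.exp (-expo ξ) := by
    rw [hξ, div_eq_iff (Complex.exp_ne_zero T), ← phi_eq_exp, mul_comm]
    exact he
  have h2 := abs_le.1 ((Complex.abs_im_le_norm (expo ξ)).trans hE.le)
  have h3 := Real.pi_gt_three
  rw [xiLift, h1, Complex.log_exp (by rw [Complex.neg_im]; linarith)
    (by rw [Complex.neg_im]; linarith)]
  ring

theorem poles_near_zero :
    ∃ ρ r : ℝ, 0 < ρ ∧ 0 < r ∧ r < 1 ∧
      (∀ x : ℂ, ‖x‖ < ρ → Summable (fun n : ℕ => xiCoeff n * x ^ (n + 1))) ∧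
      ∀ ν₁ ν₂ : ℂ, (¬ ∃ m n : ℤ, ν₁ = 2 * m ∧ ν₂ = 2 * n) →
        (∀ k N : ℤ, 2 * (N : ℂ) + ν₂ ≠ 0 → ‖xkN ν₁ ν₂ k N‖ < ρ →
          Complex.exp (xiLift (xkNLift ν₁ ν₂ k N)) = xi (xkN ν₁ ν₂ k N) ∧
          (xiLift (xkNLift ν₁ ν₂ k N)).re < 0 ∧
          IsPole (picardCov ν₁ ν₂) (xiLift (xkNLift ν₁ ν₂ k N))) ∧
        (∀ t : ℂ, ‖Complex.exp t‖ < r → IsPole (picardCov ν₁ ν₂) t →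
          ∃ k N : ℤ, 2 * (N : ℂ) + ν₂ ≠ 0 ∧ ‖xkN ν₁ ν₂ k N‖ < ρ ∧
            t = xiLift (xkNLift ν₁ ν₂ k N)) := by
  obtain ⟨ξ₀, h0, h1, hE⟩ := exists_expo_lt_one
  have hspec : ∀ x : ℂ, ‖x‖ < ξ₀ / 3 → _ := fun x hx => xi_spec h0 h1 (x := x) fun a ha => by
    have h2 : ‖phi a‖ < 3 := by
      rw [phi_eq_exp]
      exact norm_exp_lt_three (by rw [norm_neg]; exact hE a ha.le)
    rw [norm_mul]
    calc ‖x‖ * ‖phi a‖ ≤ ‖x‖ * 3 := by gcongr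
      _ < ξ₀ / 3 * 3 := by gcongr
      _ = ξ₀ := by ring
  -- `ρ = ξ₀/3` makes `|xφ(a)| < ξ₀` on the circle, as `|φ| < 3`. With `r = ξ₀/9`, a pole in `|eᵗ| <
  -- r` has `|x_{kN}| = |eᵗ||e^E| < 3r = ρ`, so Lagrange's uniqueness applies.
  refine ⟨ξ₀ / 3, ξ₀ / 9, by positivity, by positivity, by linarith,
    fun x hx => (hspec x hx).1, fun ν₁ ν₂ hν => ⟨fun k N hN hx => ?_, fun t ht hp => ?_⟩⟩
  · obtain ⟨-, hlt, heq, hu⟩ := hspec _ hx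
    have hl := xiLift_eq (T := xkNLift ν₁ ν₂ k N) (by rw [exp_xkNLift])
      (by rw [exp_xkNLift]; exact heq) (hE _ hlt.le)
    have hexp : Complex.exp (xiLift (xkNLift ν₁ ν₂ k N)) = xi (xkN ν₁ ν₂ k N) := by
      rw [hl, sub_eq_add_neg, Complex.exp_add, exp_xkNLift, ← phi_eq_exp]
      exact heq.symm
    have hlt' := hlt
    rw [← hexp] at hlt'
    refine ⟨hexp, re_neg_of_norm_exp_lt_one (hlt'.trans h1), ?_⟩
    refine isPole_picardCov h1 hE hN (fun η hη he => ?_) (exp_xkNLift ν₁ ν₂ k N) hlt' ?_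
    · rw [hexp]
      exact hu η hη he
    · rw [hexp, hl]
      ring
  · have htξ : ‖Complex.exp t‖ < ξ₀ := ht.trans (by linarith)
    have hEt := hE _ htξ.le
    obtain ⟨k, N, hN, hT⟩ := exists_of_isPole_picardCov hν
      (re_neg_of_norm_exp_lt_one (htξ.trans h1)) hEt hp
    have hx : ‖xkN ν₁ ν₂ k N‖ < ξ₀ / 3 := by
      rw [← exp_xkNLift, ← hT, Complex.exp_add, norm_mul]
      calc _ ≤ ‖Complex.exp t‖ * 3 := by
            gcongr
            exact (norm_exp_lt_three hEt).le
        _ < ξ₀ / 9 * 3 := by gcongr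
        _ = ξ₀ / 3 := by ring
    obtain ⟨-, hlt, heq, hu⟩ := hspec _ hx
    have hxi : Complex.exp t = xi (xkN ν₁ ν₂ k N) := by
      refine hu _ htξ ?_
      rw [phi_eq_exp, ← exp_xkNLift, ← hT, ← Complex.exp_add]
      congr 1
      ring
    refine ⟨k, N, hN, hx, ?_⟩
    rw [xiLift_eq (T := xkNLift ν₁ ν₂ k N) (by rw [exp_xkNLift])
      (by rw [exp_xkNLift]; exact heq) (hE _ hlt.le), ← hxi, ← hT]
    ring

end PicardPoles
end

/-! ### Spirals, rays, and the bound on one sheet. -/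

noncomputable section
namespace PicardPoles
open Filter Topology Set Metric

lemma norm_mul_phi_lt {x a : ℂ}
    (h : ‖x‖ < ‖16 * a‖ * ‖Complex.exp (F₁ a / F a)‖) : ‖x * phi a‖ < ‖a‖ := by
  have he : 0 < ‖Complex.exp (F₁ a / F a)‖ := norm_pos_iff.2 (Complex.exp_ne_zero _)
  rw [norm_mul, Complex.norm_ofNat] at h
  rw [phi, Complex.exp_neg, norm_mul, norm_mul, norm_inv, norm_div, norm_one, Complex.norm_ofNat,
    ← mul_assoc, mul_inv_lt_iff₀ he]
  linarith

theorem lagrange_series (ξ₀ : ℝ) (h0 : 0 < ξ₀) (h1 : ξ₀ < 1) (x : ℂ)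
    (hx : ∀ a : ℂ, ‖a‖ = ξ₀ → ‖x‖ < ‖16 * a‖ * ‖Complex.exp (F₁ a / F a)‖) :
    Summable (fun n : ℕ => xiCoeff n * x ^ (n + 1)) ∧ ‖xi x‖ < ξ₀ ∧
      xi x = x / 16 * Complex.exp (-(F₁ (xi x) / F (xi x))) ∧
      ∀ η : ℂ, ‖η‖ < ξ₀ → η = x / 16 * Complex.exp (-(F₁ η / F η)) → η = xi x := by
  obtain ⟨hs, hlt, heq, hu⟩ := xi_spec h0 h1 fun a ha => ha ▸ norm_mul_phi_lt (hx a ha)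
  have hphi : ∀ a, x / 16 * Complex.exp (-(F₁ a / F a)) = x * phi a := by
    intro a
    rw [phi]
    ring
  simp only [hphi]
  exact ⟨hs, hlt, heq, hu⟩

lemma two_pi_I_div {D : ℂ} (hD : D ≠ 0) :
    ((2 * Real.pi * (D.im / ‖D‖ ^ 2) : ℝ) : ℂ) +
      ((2 * Real.pi * (D.re / ‖D‖ ^ 2) : ℝ) : ℂ) * Complex.I = 2 * Real.pi * Complex.I / D := by
  have hn : (‖D‖ : ℂ) ≠ 0 := by
    simpa using hD
  have h1 : D * (starRingEnd ℂ) D = (‖D‖ : ℂ) ^ 2 := Complex.mul_conj' D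
  have h2 : (starRingEnd ℂ) D = D.re - D.im * Complex.I := by
    apply Complex.ext <;> simp
  rw [eq_div_iff hD]
  push_cast
  rw [h2] at h1
  field_simp
  linear_combination Complex.I * h1 + (D * D.im) * Complex.I_sq

lemma xkN_eq_mul_exp (ν₁ ν₂ : ℂ) (k N : ℤ) (hD : 2 * (N : ℂ) + ν₂ ≠ 0) :
    xkN ν₁ ν₂ k N = xkN ν₁ ν₂ 0 N *
      Complex.exp ((((2 * Real.pi * (ν₂.im / ‖ν₂ + 2 * N‖ ^ 2) : ℝ) : ℂ) +
        ((2 * Real.pi * ((ν₂.re + 2 * N) / ‖ν₂ + 2 * N‖ ^ 2) : ℝ) : ℂ) * Complex.I) *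
        ((k : ℝ) : ℂ)) := by
  have h := two_pi_I_div (D := ν₂ + 2 * N) (by rwa [add_comm])
  have e1 : (ν₂ + 2 * (N : ℂ)).im = ν₂.im := by simp
  have e2 : (ν₂ + 2 * (N : ℂ)).re = ν₂.re + 2 * N := by simp
  rw [e1, e2] at h
  rw [h, xkN, xkN, mul_assoc (16 : ℂ), ← Complex.exp_add, add_comm ν₂]
  congr 2
  push_cast
  field_simp
  ring

lemma norm_xkN_eq_mul_exp (ν₁ ν₂ : ℂ) (k N : ℤ) (hD : 2 * (N : ℂ) + ν₂ ≠ 0) :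
    ‖xkN ν₁ ν₂ k N‖ = ‖xkN ν₁ ν₂ 0 N‖ *
      Real.exp (2 * Real.pi * (ν₂.im / ‖ν₂ + 2 * N‖ ^ 2) * k) := by
  rw [xkN_eq_mul_exp ν₁ ν₂ k N hD, norm_mul, Complex.norm_exp]
  congr 2
  simp [-Complex.ofReal_mul, -Complex.ofReal_div, -Complex.ofReal_pow]

theorem spirals (ν₁ ν₂ : ℂ) (N : ℤ) (hD : 2 * (N : ℂ) + ν₂ ≠ 0) :
      (∀ k : ℤ, Complex.exp (xkNLift ν₁ ν₂ k N) = xkN ν₁ ν₂ k N) ∧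
      (∀ k : ℤ, xkN ν₁ ν₂ k N = xkN ν₁ ν₂ 0 N *
        Complex.exp ((2 * Real.pi * (ν₂.im / ‖ν₂ + 2 * N‖ ^ 2) * k : ℝ)) *
        Complex.exp (Complex.I *
          (2 * Real.pi * ((ν₂.re + 2 * N) / ‖ν₂ + 2 * N‖ ^ 2) * k : ℝ))) ∧
      (ν₂.im < 0 → Filter.Tendsto (fun k : ℤ => xkN ν₁ ν₂ k N) Filter.atTop (nhds 0)) ∧
      (0 < ν₂.im → Filter.Tendsto (fun k : ℤ => xkN ν₁ ν₂ k N) Filter.atBot (nhds 0)) ∧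
      (ν₂.im ≠ 0 → ν₂.re + 2 * N ≠ 0 →
        ∃ S : Set ℂ, IsLogSpiral S ∧ ∀ k : ℤ, xkN ν₁ ν₂ k N ∈ S) ∧
      (ν₂.re + 2 * N = 0 →
        ∀ k : ℤ, ∃ s : ℝ, 0 < s ∧ xkN ν₁ ν₂ k N = s * xkN ν₁ ν₂ 0 N) := by
  have hpos : 0 < ‖ν₂ + 2 * (N : ℂ)‖ ^ 2 := by
    have : ν₂ + 2 * (N : ℂ) ≠ 0 := by rwa [add_comm]
    positivity
  have hk := fun k => xkN_eq_mul_exp ν₁ ν₂ k N hD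
  have hn := fun k => norm_xkN_eq_mul_exp ν₁ ν₂ k N hD
  have hπ := Real.pi_pos
  refine ⟨fun k => exp_xkNLift ν₁ ν₂ k N, fun k => ?_, fun h => ?_, fun h => ?_, fun h1 h2 => ?_,
    fun h k => ?_⟩
  · rw [hk k, mul_assoc (xkN ν₁ ν₂ 0 N), ← Complex.exp_add]
    congr 2
    push_cast
    ring
  · rw [tendsto_zero_iff_norm_tendsto_zero]
    refine Tendsto.congr (fun k => (hn k).symm) ?_
    have hc : 2 * Real.pi * (ν₂.im / ‖ν₂ + 2 * N‖ ^ 2) < 0 :=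
      mul_neg_of_pos_of_neg (by positivity) (div_neg_of_neg_of_pos h hpos)
    have := (Real.tendsto_exp_atBot.comp
      (tendsto_intCast_atTop_atTop.const_mul_atTop_of_neg hc)).const_mul ‖xkN ν₁ ν₂ 0 N‖
    simpa only [mul_zero, Function.comp_apply] using this
  · rw [tendsto_zero_iff_norm_tendsto_zero]
    refine Tendsto.congr (fun k => (hn k).symm) ?_
    have hc : 0 < 2 * Real.pi * (ν₂.im / ‖ν₂ + 2 * N‖ ^ 2) := by positivity
    have hb : Tendsto (fun k : ℤ => (k : ℝ)) atBot atBot := tendsto_intCast_atBot_iff.2 tendsto_id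
    have := (Real.tendsto_exp_atBot.comp (hb.const_mul_atBot hc)).const_mul ‖xkN ν₁ ν₂ 0 N‖
    simpa only [mul_zero, Function.comp_apply] using this
  -- The spiral is the formula for `x_{kN}` with the integer `k` replaced by a real parameter.
  · exact ⟨_, ⟨xkN ν₁ ν₂ 0 N, 2 * Real.pi * (ν₂.im / ‖ν₂ + 2 * N‖ ^ 2),
      2 * Real.pi * ((ν₂.re + 2 * N) / ‖ν₂ + 2 * N‖ ^ 2), xkN_ne_zero _ _ _ _,
      mul_ne_zero (by positivity) (div_ne_zero h1 hpos.ne'),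
      mul_ne_zero (by positivity) (div_ne_zero h2 hpos.ne'), rfl⟩, fun k => ⟨k, (hk k).symm⟩⟩
  · refine ⟨_, Real.exp_pos (2 * Real.pi * (ν₂.im / ‖ν₂ + 2 * N‖ ^ 2) * k), ?_⟩
    rw [hk k, h, mul_comm]
    push_cast
    congr 2
    ring

/-- The numbers `c + 2N` have spacing `2`, so at most one lies in `(-1, 1)`. Its absolute value, if
nonzero, is the minimum; otherwise `δ = 1` works. -/
lemma exists_pos_le_abs_add_two_mul (c : ℝ) :
    ∃ δ : ℝ, 0 < δ ∧ ∀ N : ℤ, c + 2 * N ≠ 0 → δ ≤ |c + 2 * N| := by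
  by_cases h : ∃ M : ℤ, c + 2 * M ≠ 0 ∧ |c + 2 * M| < 1
  · obtain ⟨M, h0, h1⟩ := h
    refine ⟨|c + 2 * M|, abs_pos.2 h0, fun N _ => ?_⟩
    by_contra! hlt
    have h2 := abs_lt.1 h1
    have h3 := abs_lt.1 (hlt.trans h1)
    have h4 : (N : ℝ) < M + 1 := by linarith
    have h5 : (M : ℝ) < N + 1 := by linarith
    have h6 : N < M + 1 := by exact_mod_cast h4
    have h7 : M < N + 1 := by exact_mod_cast h5
    have h8 : N = M := by omega
    rw [h8] at hlt
    exact lt_irrefl _ hlt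
  · push Not at h
    exact ⟨1, one_pos, fun N hN => h N hN⟩

theorem sheet_bound (ν₁ ν₂ : ℂ) : ∃ ε : ℝ, 0 < ε ∧ ∀ k N : ℤ, ν₂.re + 2 * N ≠ 0 →
      -Real.pi ≤ (xkNLift ν₁ ν₂ k N).im → (xkNLift ν₁ ν₂ k N).im < Real.pi →
      ε ≤ ‖xkN ν₁ ν₂ k N‖ := by
  obtain ⟨δ, hδ, hle⟩ := exists_pos_le_abs_add_two_mul ν₂.re
  refine ⟨16 * Real.exp (-(Real.pi * ((|ν₁.im| + |ν₂.im|) / δ))), by positivity,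
    fun k N hN h1 h2 => ?_⟩
  have hπ := Real.pi_pos
  have hD : 2 * (N : ℂ) + ν₂ ≠ 0 := by
    intro h0
    have := congrArg Complex.re h0
    simp at this
    exact hN (by linarith)
  set w := (2 * (k : ℂ) - ν₁) / (2 * N + ν₂) with hw
  have him : (xkNLift ν₁ ν₂ k N).im = Real.pi * w.re := by
    rw [xkNLift, ← hw, Complex.add_im, Complex.ofReal_im]
    simp
  have hnorm : ‖xkN ν₁ ν₂ k N‖ = 16 * Real.exp (-(Real.pi * w.im)) := by
    rw [xkN, ← hw, norm_mul, Complex.norm_exp, Complex.norm_ofNat]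
    simp
  rw [him] at h1 h2
  have hre : |w.re| ≤ 1 := abs_le.2 ⟨by nlinarith, by nlinarith⟩
  have hwD : w * (2 * N + ν₂) = 2 * k - ν₁ := div_mul_cancel₀ _ hD
  -- Taking imaginary parts eliminates `k`: `Im w · (Re ν₂ + 2N) = -Im ν₁ - Re w · Im ν₂`. The sheet
  -- condition gives `|Re w| ≤ 1`, so `Im w` is bounded uniformly in `k` and `N`, and with it
  -- `|x_{kN}| = 16 e^(-π Im w)` from below.
  have hi := congrArg Complex.im hwD
  simp at hi
  have hb : |w.im| * δ ≤ |ν₁.im| + |ν₂.im| := by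
    calc |w.im| * δ ≤ |w.im| * |ν₂.re + 2 * N| := by
          gcongr
          exact hle N hN
      _ = |(-ν₁.im) - w.re * ν₂.im| := by
          rw [← abs_mul]
          congr 1
          linarith
      _ ≤ |-ν₁.im| + |w.re * ν₂.im| := abs_sub _ _
      _ ≤ |ν₁.im| + |ν₂.im| := by
          rw [abs_neg, abs_mul]
          have := mul_le_mul_of_nonneg_right hre (abs_nonneg ν₂.im)
          linarith
  rw [hnorm]
  gcongr
  exact (le_abs_self _).trans ((le_div_iff₀ hδ).2 hb)

end PicardPoles
end

theorem mainTheorem10 :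
    -- the half-periods continue holomorphically to the universal covering of `0 < |x| < 1`
    (DifferentiableOn ℂ PicardPoles.omega1Cov {t : ℂ | t.re < 0} ∧
      DifferentiableOn ℂ PicardPoles.omega2Cov {t : ℂ | t.re < 0} ∧
      ∀ t : ℂ, t.re < 0 → |t.im| < Real.pi →
        PicardPoles.omega1 (Complex.exp t) = PicardPoles.omega1Cov t ∧
        PicardPoles.omega2 (Complex.exp t) = PicardPoles.omega2Cov t ∧
        ∀ ν₁ ν₂ : ℂ,
          PicardPoles.picard ν₁ ν₂ (Complex.exp t) = PicardPoles.picardCov ν₁ ν₂ t) ∧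
    -- Lagrange inversion of `ξ = (x / 16) exp(-F₁(ξ) / F(ξ))`
    (∀ a : ℂ, ‖a‖ < 1 → PicardPoles.F a ≠ 0) ∧
    DifferentiableOn ℂ PicardPoles.phi (Metric.ball 0 1) ∧
    (∀ ξ₀ : ℝ, 0 < ξ₀ → ξ₀ < 1 → ∀ x : ℂ,
      (∀ a : ℂ, ‖a‖ = ξ₀ →
        ‖x‖ < ‖16 * a‖ * ‖Complex.exp (PicardPoles.F₁ a / PicardPoles.F a)‖) →
      Summable (fun n : ℕ => PicardPoles.xiCoeff n * x ^ (n + 1)) ∧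
      ‖PicardPoles.xi x‖ < ξ₀ ∧
      PicardPoles.xi x = x / 16 *
        Complex.exp (-(PicardPoles.F₁ (PicardPoles.xi x) / PicardPoles.F (PicardPoles.xi x))) ∧
      ∀ η : ℂ, ‖η‖ < ξ₀ →
        η = x / 16 * Complex.exp (-(PicardPoles.F₁ η / PicardPoles.F η)) →
        η = PicardPoles.xi x) ∧
    -- the series converges near `0`, and its first coefficients
    (∃ R : ℝ, 0 < R ∧ ∀ x : ℂ, ‖x‖ < R →
      Summable (fun n : ℕ => PicardPoles.xiCoeff n * x ^ (n + 1))) ∧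
    (PicardPoles.xiCoeff 0 = 1 ∧ PicardPoles.xiCoeff 1 = -1 / 2 ∧
      PicardPoles.xiCoeff 2 = 11 / 64 ∧ PicardPoles.xiCoeff 3 = -3 / 64 ∧
      PicardPoles.xiCoeff 4 = 359 / 32768 ∧ PicardPoles.xiCoeff 5 = -75 / 32768 ∧
      PicardPoles.xiCoeff 6 = 919 / 2097152) ∧
    -- near `x = 0`, the poles on the universal covering are exactly the points `ξ(x_{kN})`
    (∃ ρ r : ℝ, 0 < ρ ∧ 0 < r ∧ r < 1 ∧
      (∀ x : ℂ, ‖x‖ < ρ → Summable (fun n : ℕ => PicardPoles.xiCoeff n * x ^ (n + 1))) ∧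
      ∀ ν₁ ν₂ : ℂ, (¬ ∃ m n : ℤ, ν₁ = 2 * m ∧ ν₂ = 2 * n) →
        (∀ k N : ℤ, 2 * (N : ℂ) + ν₂ ≠ 0 → ‖PicardPoles.xkN ν₁ ν₂ k N‖ < ρ →
          Complex.exp (PicardPoles.xiLift (PicardPoles.xkNLift ν₁ ν₂ k N)) =
            PicardPoles.xi (PicardPoles.xkN ν₁ ν₂ k N) ∧
          (PicardPoles.xiLift (PicardPoles.xkNLift ν₁ ν₂ k N)).re < 0 ∧
          PicardPoles.IsPole (PicardPoles.picardCov ν₁ ν₂)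
            (PicardPoles.xiLift (PicardPoles.xkNLift ν₁ ν₂ k N))) ∧
        (∀ t : ℂ, ‖Complex.exp t‖ < r → PicardPoles.IsPole (PicardPoles.picardCov ν₁ ν₂) t →
          ∃ k N : ℤ, 2 * (N : ℂ) + ν₂ ≠ 0 ∧ ‖PicardPoles.xkN ν₁ ν₂ k N‖ < ρ ∧
            t = PicardPoles.xiLift (PicardPoles.xkNLift ν₁ ν₂ k N))) ∧
    -- for fixed `N`, the points `x_{kN}` lie along a spiral (or a ray) and accumulate at `0`
    (∀ (ν₁ ν₂ : ℂ) (N : ℤ), 2 * (N : ℂ) + ν₂ ≠ 0 →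
      (∀ k : ℤ, Complex.exp (PicardPoles.xkNLift ν₁ ν₂ k N) = PicardPoles.xkN ν₁ ν₂ k N) ∧
      (∀ k : ℤ, PicardPoles.xkN ν₁ ν₂ k N = PicardPoles.xkN ν₁ ν₂ 0 N *
        Complex.exp ((2 * Real.pi * (ν₂.im / ‖ν₂ + 2 * N‖ ^ 2) * k : ℝ)) *
        Complex.exp (Complex.I *
          (2 * Real.pi * ((ν₂.re + 2 * N) / ‖ν₂ + 2 * N‖ ^ 2) * k : ℝ))) ∧
      (ν₂.im < 0 → Filter.Tendsto (fun k : ℤ => PicardPoles.xkN ν₁ ν₂ k N) Filter.atTop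
        (nhds 0)) ∧
      (0 < ν₂.im → Filter.Tendsto (fun k : ℤ => PicardPoles.xkN ν₁ ν₂ k N) Filter.atBot
        (nhds 0)) ∧
      (ν₂.im ≠ 0 → ν₂.re + 2 * N ≠ 0 →
        ∃ S : Set ℂ, PicardPoles.IsLogSpiral S ∧ ∀ k : ℤ, PicardPoles.xkN ν₁ ν₂ k N ∈ S) ∧
      (ν₂.re + 2 * N = 0 →
        ∀ k : ℤ, ∃ s : ℝ, 0 < s ∧
          PicardPoles.xkN ν₁ ν₂ k N = s * PicardPoles.xkN ν₁ ν₂ 0 N)) ∧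
    -- on the sheet `-π ≤ arg x < π`, only points on a ray accumulate at `0`
    (∀ ν₁ ν₂ : ℂ, ∃ ε : ℝ, 0 < ε ∧ ∀ k N : ℤ, ν₂.re + 2 * N ≠ 0 →
      -Real.pi ≤ (PicardPoles.xkNLift ν₁ ν₂ k N).im →
      (PicardPoles.xkNLift ν₁ ν₂ k N).im < Real.pi →
      ε ≤ ‖PicardPoles.xkN ν₁ ν₂ k N‖) := by
  refine ⟨⟨PicardPoles.differentiableOn_omega1Cov, PicardPoles.differentiableOn_omega2Cov,
      fun t ht hi => ?_⟩, fun a ha => PicardPoles.F_ne_zero ha, PicardPoles.differentiableOn_phi,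
    PicardPoles.lagrange_series, ?_, PicardPoles.xiCoeff_values, PicardPoles.poles_near_zero,
    PicardPoles.spirals, PicardPoles.sheet_bound⟩
  · have h1 := PicardPoles.omega1_exp ht
    have h2 := PicardPoles.omega2_exp ht hi
    refine ⟨h1, h2, fun ν₁ ν₂ => ?_⟩
    rw [PicardPoles.picard, PicardPoles.picardCov, h1, h2]
  · obtain ⟨ρ, -, hρ, -, -, hs, -⟩ := PicardPoles.poles_near_zero
    exact ⟨ρ, hρ, hs⟩
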